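/- **Conventions.** Compact spaces need not be Hausdorff. Let $X$ be a locally compact Hausdorff space and let $Y$ be a $\sigma$-compact space in which every point has a compact Hausdorff neighbourhood ($Y$ itself need not be Hausdorff). $\mathcal C_c(Y)$ denotes the linear span, in the space of functions $Y\to\mathbb C$, of the extensions by $0$ of the functions in $C_c(U)$, where $U$ runs over the Hausdorff open subsets of $Y$. Let $\pi:Y\to X$ be a continuous surjection whose fibres $\pi^{-1}(x)$ are Hausdorff, and let $\alpha=(\alpha^x)_{x\in X}$ be a full continuous $\pi$-system: each $\alpha^x$ is a positive Radon measure of full support on $\pi^{-1}(x)$ and, for every $f\in\mathcal C_c(Y)$, the function $x\mapsto\int f\,d\alpha^x$ belongs to $C_c(X)$. Let $C_0(X,L^1(Y,\alpha))$ be the completion of $\mathcal C_c(Y)$ for the norm $\|f\|=\sup_{x\in X}\int|f|\,d\alpha^x$. For a finite positive Radon measure $\mu$ on $X$, let $\mu\circ\alpha$ be the measure $B\mapsto\int\alpha^x(B\cap\pi^{-1}(x))\,d\mu(x)$ on the Borel subsets of $Y$. A complex Borel Radon measure on $Y$ is a complex-valued, countably additive, inner regular function $\nu$ on the Borel sets contained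 in compact subsets of $Y$; inner regular means that for every such $B$ and every $\varepsilon>0$ there is a compact Borel set $C\subset B$ with $|\nu(A)|<\varepsilon$ for all Borel $A\subset B\setminus C$. For $\varphi\in L^\infty(Y,\mu\circ\alpha)$, the equality $\nu=\varphi(\mu\circ\alpha)$ means that $\nu(B)=\int_B\varphi\,d(\mu\circ\alpha)$ for all such $B$. **Proposition 2.5.** 1. For every continuous linear form $\Phi$ on $C_0(X,L^1(Y,\alpha))$ there is a complex Borel Radon measure $\nu$ on $Y$ such that, for all finite positive Radon measures $\mu$ on $X$ and all $\varphi\in L^\infty(Y,\mu\circ\alpha)$, one has $$\nu=\varphi(\mu\circ\alpha)\iff \Phi(f)=\int f\varphi\,d(\mu\circ\alpha)\ \text{ for all } f\in\mathcal C_c(Y).$$ At least one such representation $\nu=\varphi(\mu\circ\alpha)$ exists, and $$\|\Phi\|=\inf\|\mu\|_1\|\varphi\|_\infty,$$ where the infimum is taken over all the representations $\nu=\varphi(\mu\circ\alpha)$ with $\mu$ a finite positive Radon measure on $X$ and $\varphi\in L^\infty(Y,\mu\circ\alpha)$. 2. Conversely, for every finite positive Radon measure $\mu$ on $X$ and every $\varphi\in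 L^\infty(Y,\mu\circ\alpha)$ there is exactly one continuous linear form $\Phi$ on $C_0(X,L^1(Y,\alpha))$ with $\Phi(f)=\int f\varphi\,d(\mu\circ\alpha)$ for all $f\in\mathcal C_c(Y)$. -/

import Mathlib

open MeasureTheory Set Filter Topology
open scoped ENNReal

noncomputable section

namespace FibredMeasure

/-- Local compactness in the not necessarily Hausdorff sense: every point has a compact Hausdorff
neighbourhood. -/
def LocallyCompactLocallyHausdorff (Y : Type*) [TopologicalSpace Y] : Prop :=
  ∀ y : Y, ∃ K : Set Y, K ∈ 𝓝 y ∧ IsCompact K ∧ T2Space K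

/-- `f : Y → ℂ` is the extension by `0` of a continuous function with compact support on some
Hausdorff open subset `U` of `Y`. -/
def IsExtensionByZero {Y : Type*} [TopologicalSpace Y] (f : Y → ℂ) : Prop :=
  ∃ U : Set Y, IsOpen U ∧ T2Space U ∧ ContinuousOn f U ∧
    ∃ K : Set Y, IsCompact K ∧ K ⊆ U ∧ ∀ y, y ∉ K → f y = 0

/-- Connes' space `𝒞_c(Y)`: the linear span of the functions in `C_c(U)`, extended by zero, for `U`
running over the Hausdorff open subsets of `Y`. -/
def Cc (Y : Type*) [TopologicalSpace Y] : Submodule ℂ (Y → ℂ) :=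
  Submodule.span ℂ {f | IsExtensionByZero f}

section System

variable {X Y : Type*} [TopologicalSpace X] [TopologicalSpace Y] [MeasurableSpace Y]

/-- A full continuous `π`-system: a family of positive Radon measures `α^x` of full support on the
fibres `π⁻¹(x)` such that `x ↦ ∫ f dα^x` is in `C_c(X)` for each `f ∈ 𝒞_c(Y)`
(the space `X` is Hausdorff in all uses). -/
structure FullContinuousSystem (π : C(Y, X)) where
  /-- the measure on the fibre over `x` -/
  fibreMeasure : ∀ x : X, Measure (π ⁻¹' {x})
  regular : ∀ x, (fibreMeasure x).Regular
  full : ∀ x, (fibreMeasure x).IsOpenPosMeasure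
  continuous_integral : ∀ f ∈ Cc Y, Continuous fun x => ∫ y, f y ∂(fibreMeasure x)
  hasCompactSupport_integral : ∀ f ∈ Cc Y, HasCompactSupport fun x => ∫ y, f y ∂(fibreMeasure x)

theorem isCompact_preimage_fibre {X Y : Type*} [TopologicalSpace X] [TopologicalSpace Y]
    {π : C(Y, X)} [T1Space X] {K : Set Y} (hK : IsCompact K) (x : X) :
    IsCompact ((Subtype.val : (π ⁻¹' {x}) → Y) ⁻¹' K) := by
  have hcl : IsClosed (π ⁻¹' {x}) := isClosed_singleton.preimage π.continuous
  exact hcl.isClosedEmbedding_subtypeVal.isCompact_preimage hK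

variable {π : C(Y, X)}

/-- The measure `α^x`, seen as a measure on `Y` carried by the fibre over `x`. -/
def FullContinuousSystem.onTotal (α : FullContinuousSystem π) (x : X) : Measure Y :=
  (α.fibreMeasure x).map Subtype.val

/-- The measure `μ ∘ α = ∫ α^x dμ(x)` on `Y`. -/
def FullContinuousSystem.comp (α : FullContinuousSystem π) [MeasurableSpace X] (μ : Measure X) :
    Measure Y :=
  μ.bind α.onTotal

/-- The vector space `𝒞_c(Y)`, to be given the norm `‖f‖ = sup_x ∫ |f| dα^x`. -/
def CcL1 (_α : FullContinuousSystem π) : Type _ := Cc Y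

instance (α : FullContinuousSystem π) : AddCommGroup (CcL1 α) :=
  inferInstanceAs (AddCommGroup (Cc Y))

instance (α : FullContinuousSystem π) : Module ℂ (CcL1 α) :=
  inferInstanceAs (Module ℂ (Cc Y))

instance (α : FullContinuousSystem π) : CoeFun (CcL1 α) (fun _ => Y → ℂ) :=
  ⟨fun f => f.1⟩

theorem IsExtensionByZero.measurable [BorelSpace Y] {f : Y → ℂ} (hf : IsExtensionByZero f) :
    Measurable f := by
  classical
  obtain ⟨U, hU, -, hc, K, -, hKU, h0⟩ := hf
  have h : f = U.piecewise f (fun _ => 0) := by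
    funext y
    by_cases hy : y ∈ U
    · simp [hy]
    · simp [hy, h0 y (fun hk => hy (hKU hk))]
  rw [h]
  exact ContinuousOn.measurable_piecewise hc continuousOn_const hU.measurableSet

theorem IsExtensionByZero.norm {Y : Type*} [TopologicalSpace Y] {f : Y → ℂ} (hf : IsExtensionByZero f) :
    IsExtensionByZero (fun y => ((‖f y‖ : ℝ) : ℂ)) := by
  obtain ⟨U, hU, hT, hc, K, hK, hKU, h0⟩ := hf
  refine ⟨U, hU, hT, ?_, K, hK, hKU, fun y hy => by simp [h0 y hy]⟩
  exact Complex.continuous_ofReal.comp_continuousOn hc.norm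

theorem FullContinuousSystem.onTotal_apply (α : FullContinuousSystem π) (x : X) {B : Set Y}
    (hB : MeasurableSet B) : α.onTotal x B = α.fibreMeasure x (Subtype.val ⁻¹' B) :=
  Measure.map_apply measurable_subtype_coe hB

variable [BorelSpace Y]

theorem FullContinuousSystem.integrable_basic [T1Space X] (α : FullContinuousSystem π)
    {f : Y → ℂ} (hf : IsExtensionByZero f) (x : X) :
    Integrable (fun y : π ⁻¹' {x} => f y) (α.fibreMeasure x) := by
  have hm := hf.measurable
  obtain ⟨U, hU, hT, hc, K, hK, hKU, h0⟩ := hf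
  have := α.regular x
  obtain ⟨C, hC⟩ := hK.exists_bound_of_continuousOn (hc.mono hKU)
  have hms : AEStronglyMeasurable (fun y : π ⁻¹' {x} => f y) (α.fibreMeasure x) :=
    (hm.comp measurable_subtype_coe).aestronglyMeasurable
  have hfin : α.fibreMeasure x ((Subtype.val : (π ⁻¹' {x}) → Y) ⁻¹' K) < ∞ :=
    (isCompact_preimage_fibre hK x).measure_lt_top
  set S := toMeasurable (α.fibreMeasure x) ((Subtype.val : (π ⁻¹' {x}) → Y) ⁻¹' K) with hS
  have hSub := subset_toMeasurable (α.fibreMeasure x) ((Subtype.val : (π ⁻¹' {x}) → Y) ⁻¹' K)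
  have hSm : MeasurableSet S := measurableSet_toMeasurable _ _
  have hg : Integrable (S.indicator fun _ => (max C 0 : ℝ)) (α.fibreMeasure x) := by
    refine (integrable_indicator_iff hSm).2 (integrableOn_const ?_)
    rw [hS, measure_toMeasurable]
    exact hfin.ne
  refine hg.mono' hms (Eventually.of_forall fun y => ?_)
  by_cases hy : (y : Y) ∈ K
  · have : y ∈ S := hSub hy
    simp only [indicator_of_mem this]
    exact (hC _ hy).trans (le_max_left _ _)
  · rw [h0 _ hy, norm_zero]
    exact indicator_nonneg (fun _ _ => le_max_right _ _) _

theorem LocallyCompactLocallyHausdorff.locallyCompactSpace {Y : Type*} [TopologicalSpace Y]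
    (hY : LocallyCompactLocallyHausdorff Y) {V : Set Y} (hV : IsOpen V) [T2Space V] :
    LocallyCompactSpace V := by
  have : WeaklyLocallyCompactSpace V := by
    refine ⟨fun v => ?_⟩
    obtain ⟨K, hK, hKc, hKT⟩ := hY v
    have : CompactSpace K := isCompact_iff_compactSpace.1 hKc
    have hvK : (v : Y) ∈ K := mem_of_mem_nhds hK
    have hn : (Subtype.val : K → Y) ⁻¹' V ∈ 𝓝 (⟨v, hvK⟩ : K) :=
      (hV.preimage continuous_subtype_val).mem_nhds v.2
    obtain ⟨L, hL, hLV, hLc⟩ := local_compact_nhds hn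
    have hL' : Subtype.val '' L ∈ 𝓝 (v : Y) := by
      have h := image_mem_map (m := (Subtype.val : K → Y)) hL
      rw [map_nhds_subtype_val] at h
      rwa [nhdsWithin_eq_nhds.2 hK] at h
    have hsub : Subtype.val '' L ⊆ V := by
      rintro _ ⟨y, hy, rfl⟩
      exact hLV hy
    refine ⟨Subtype.val ⁻¹' (Subtype.val '' L), ?_, ?_⟩
    · rw [Topology.IsInducing.subtypeVal.isCompact_preimage_iff (by simpa using hsub)]
      exact hLc.image continuous_subtype_val
    · exact continuous_subtype_val.continuousAt.preimage_mem_nhds hL'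
  infer_instance

theorem FullContinuousSystem.lowerSemicontinuous_open [T1Space X] (α : FullContinuousSystem π)
    (hY : LocallyCompactLocallyHausdorff Y) {V : Set Y} (hV : IsOpen V) [T2Space V] :
    LowerSemicontinuous fun x => α.onTotal x V := by
  classical
  have hlc := hY.locallyCompactSpace hV
  intro x r hr
  have := α.regular x
  simp only [α.onTotal_apply _ hV.measurableSet] at hr
  obtain ⟨C, hCV, hC, hrC⟩ := (hV.preimage continuous_subtype_val).exists_lt_isCompact hr
  have hC' : IsCompact ((Subtype.val : V → Y) ⁻¹' (Subtype.val '' C)) := by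
    rw [Topology.IsInducing.subtypeVal.isCompact_preimage_iff (by simpa using hCV)]
    exact hC.image continuous_subtype_val
  obtain ⟨g, hg1, -, hgc, hg01⟩ := exists_continuous_one_zero_of_isCompact hC' isClosed_empty
    (disjoint_empty _)
  set F : Y → ℝ := fun y => if h : y ∈ V then g ⟨y, h⟩ else 0 with hF
  have hF0 : ∀ y, 0 ≤ F y := fun y => by
    by_cases h : y ∈ V <;> simp [hF, h, (hg01 _).1]
  have hF1 : ∀ y, F y ≤ V.indicator 1 y := fun y => by
    by_cases h : y ∈ V <;> simp [hF, h, (hg01 _).2]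
  have hFC : ∀ y ∈ C, F y = 1 := fun y hy => by
    have h : (y : Y) ∈ V := hCV hy
    have h1 := hg1 (show (⟨y, h⟩ : V) ∈ _ from ⟨y, hy, rfl⟩)
    simpa [hF, h] using h1
  have hFb : IsExtensionByZero fun y => (F y : ℂ) := by
    refine ⟨V, hV, inferInstance, ?_, Subtype.val '' tsupport g,
      IsCompact.image hgc continuous_subtype_val, ?_, ?_⟩
    · refine Complex.continuous_ofReal.comp_continuousOn ?_
      rw [continuousOn_iff_continuous_domRestrict]
      convert g.continuous using 1
      funext y
      simp [hF]
    · rintro _ ⟨y, -, rfl⟩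
      exact y.2
    · intro y hy
      by_cases h : y ∈ V
      · have : g ⟨y, h⟩ = 0 := by
          by_contra hne
          exact hy ⟨⟨y, h⟩, subset_tsupport _ hne, rfl⟩
        simp [hF, h, this]
      · simp [hF, h]
  have hint : ∀ x', Integrable (fun y : π ⁻¹' {x'} => F y) (α.fibreMeasure x') := fun x' => by
    simpa using (α.integrable_basic hFb x').re
  have hcont : Continuous fun x' => ∫ y, F y ∂(α.fibreMeasure x') := by
    have h := Complex.continuous_re.comp (α.continuous_integral _ (Submodule.subset_span hFb))
    convert h using 1
    funext x'
    simp only [Function.comp]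
    rw [integral_complex_ofReal, Complex.ofReal_re]
  have hcont' : Continuous fun x' => ENNReal.ofReal (∫ y, F y ∂(α.fibreMeasure x')) :=
    ENNReal.continuous_ofReal.comp hcont
  have hlarge : r < ENNReal.ofReal (∫ y, F y ∂(α.fibreMeasure x)) := by
    refine hrC.trans_le ?_
    rw [ofReal_integral_eq_lintegral_ofReal (hint x) (Eventually.of_forall fun y => hF0 y)]
    have hm : AEMeasurable (fun y : π ⁻¹' {x} => ENNReal.ofReal (F y)) (α.fibreMeasure x) :=
      (hint x).aestronglyMeasurable.aemeasurable.ennreal_ofReal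
    have h := mul_meas_ge_le_lintegral₀ hm 1
    rw [one_mul] at h
    refine (measure_mono fun y hy => ?_).trans h
    simp [hFC y hy]
  filter_upwards [hcont'.continuousAt.eventually (lt_mem_nhds hlarge)] with x' hx'
  refine hx'.trans_le ?_
  rw [α.onTotal_apply _ hV.measurableSet,
    ofReal_integral_eq_lintegral_ofReal (hint x') (Eventually.of_forall fun y => hF0 y),
    ← lintegral_indicator_one (measurable_subtype_coe hV.measurableSet)]
  refine lintegral_mono fun y => ?_
  have h := hF1 y
  by_cases hy : (y : Y) ∈ V
  · simp only [hy, indicator_of_mem, Pi.one_apply] at h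
    simpa [indicator, hy] using h
  · simp only [hy, not_false_eq_true, indicator_of_notMem] at h
    simpa [indicator, hy] using h

/-- The family `x ↦ α^x` is a measurable family of measures on `Y`, so that `μ ∘ α` is given
by `(μ ∘ α)(B) = ∫ α^x(B) dμ(x)`. -/
theorem FullContinuousSystem.measurable_onTotal [T1Space X] [MeasurableSpace X] [BorelSpace X]
    [SigmaCompactSpace Y] (α : FullContinuousSystem π) (hY : LocallyCompactLocallyHausdorff Y) :
    Measurable α.onTotal := by
  choose K hKn hKc hKT using hY
  obtain ⟨s, hs, hcov⟩ := countable_cover_nhds_of_sigmaCompact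
    (f := fun y => interior (K y)) fun y => interior_mem_nhds.2 (hKn y)
  have hT2 : ∀ y, ∀ W ⊆ interior (K y), T2Space W := fun y W hW =>
    have := hKT y
    T2Space.of_injective_continuous (inclusion_injective (hW.trans interior_subset))
      (continuous_inclusion (hW.trans interior_subset))
  have hrestr : ∀ y, Measurable fun x => (α.onTotal x).restrict (interior (K y)) := by
    intro y
    have hfin : ∀ x, IsFiniteMeasure ((α.onTotal x).restrict (interior (K y))) := fun x => by
      have := α.regular x
      refine ⟨?_⟩
      rw [Measure.restrict_apply_univ, α.onTotal_apply _ isOpen_interior.measurableSet]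
      exact (measure_mono (preimage_mono interior_subset)).trans_lt
        (isCompact_preimage_fibre (hKc y) x).measure_lt_top
    have hopen : ∀ W : Set Y, IsOpen W →
        Measurable fun x => (α.onTotal x).restrict (interior (K y)) W := fun W hW => by
      have := hT2 y (W ∩ interior (K y)) inter_subset_right
      simp only [Measure.restrict_apply hW.measurableSet]
      exact (α.lowerSemicontinuous_open (fun y => ⟨K y, hKn y, hKc y, hKT y⟩)
        (hW.inter isOpen_interior)).measurable
    exact Measurable.measure_of_isPiSystem BorelSpace.measurable_eq isPiSystem_isOpen hopen
      (hopen univ isOpen_univ)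
  refine Measure.measurable_of_measurable_coe _ fun B hB => ?_
  rcases s.eq_empty_or_nonempty with hse | hsne
  · have : B = ∅ := by
      have h : (univ : Set Y) = ∅ := by rw [← hcov, hse]; simp
      exact subset_empty_iff.1 (h ▸ subset_univ B)
    simp [this]
  obtain ⟨e, he⟩ := hs.exists_eq_range hsne
  set U : ℕ → Set Y := fun n => interior (K (e n)) with hU
  have hUm : ∀ n, MeasurableSet (U n) := fun n => isOpen_interior.measurableSet
  have hUcov : ⋃ n, disjointed U n = univ := by
    rw [iUnion_disjointed, ← hcov, he, biUnion_range]
  have hsum : ∀ x, α.onTotal x B =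
      ∑' n, (α.onTotal x).restrict (U n) (B ∩ disjointed U n) := fun x => by
    conv_lhs => rw [← inter_univ B, ← hUcov, inter_iUnion]
    rw [measure_iUnion]
    · refine tsum_congr fun n => ?_
      rw [Measure.restrict_apply (hB.inter (MeasurableSet.disjointed hUm n)),
        inter_assoc, inter_eq_self_of_subset_left (disjointed_subset U n)]
    · exact fun i j hij => (disjoint_disjointed U hij).mono inter_subset_right inter_subset_right
    · exact fun n => hB.inter (MeasurableSet.disjointed hUm n)
  simp only [hsum]
  exact Measurable.tsum fun n =>
    (Measure.measurable_coe (hB.inter (MeasurableSet.disjointed hUm n))).comp (hrestr (e n))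

theorem FullContinuousSystem.comp_apply [T1Space X] [MeasurableSpace X] [BorelSpace X]
    [SigmaCompactSpace Y] (α : FullContinuousSystem π) (hY : LocallyCompactLocallyHausdorff Y)
    (μ : Measure X) {B : Set Y} (hB : MeasurableSet B) :
    α.comp μ B = ∫⁻ x, α.onTotal x B ∂μ :=
  Measure.bind_apply hB (α.measurable_onTotal hY).aemeasurable

theorem FullContinuousSystem.integrable [T1Space X] (α : FullContinuousSystem π)
    {f : Y → ℂ} (hf : f ∈ Cc Y) (x : X) :
    Integrable (fun y : π ⁻¹' {x} => f y) (α.fibreMeasure x) := by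
  induction hf using Submodule.span_induction with
  | mem f hf => exact α.integrable_basic hf x
  | zero => exact integrable_zero _ _ _
  | add f g _ _ hf hg => exact hf.add hg
  | smul c f _ hf => exact hf.smul c

theorem FullContinuousSystem.bddAbove [T1Space X] (α : FullContinuousSystem π)
    {f : Y → ℂ} (hf : f ∈ Cc Y) :
    BddAbove (range fun x => ∫ y, ‖f y‖ ∂(α.fibreMeasure x)) := by
  induction hf using Submodule.span_induction with
  | mem f hf =>
    have hm : (fun y => ((‖f y‖ : ℝ) : ℂ)) ∈ Cc Y := Submodule.subset_span hf.norm
    obtain ⟨C, hC⟩ := (α.hasCompactSupport_integral _ hm).exists_bound_of_continuous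
      (α.continuous_integral _ hm)
    refine ⟨C, ?_⟩
    rintro _ ⟨x, rfl⟩
    have h := hC x
    rw [integral_complex_ofReal, Complex.norm_real] at h
    exact (le_abs_self _).trans h
  | zero => exact ⟨0, by rintro _ ⟨x, rfl⟩; simp⟩
  | add f g hf' hg' hf hg =>
    obtain ⟨C, hC⟩ := hf
    obtain ⟨D, hD⟩ := hg
    refine ⟨C + D, ?_⟩
    rintro _ ⟨x, rfl⟩
    refine le_trans ?_ (add_le_add (hC ⟨x, rfl⟩) (hD ⟨x, rfl⟩))
    rw [← integral_add (α.integrable hf' x).norm (α.integrable hg' x).norm]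
    exact integral_mono ((α.integrable hf' x).add (α.integrable hg' x)).norm
      ((α.integrable hf' x).norm.add (α.integrable hg' x).norm) fun y => norm_add_le _ _
  | smul c f _ hf =>
    obtain ⟨C, hC⟩ := hf
    refine ⟨‖c‖ * C, ?_⟩
    rintro _ ⟨x, rfl⟩
    simp only [Pi.smul_apply, norm_smul]
    rw [integral_const_mul]
    exact mul_le_mul_of_nonneg_left (hC ⟨x, rfl⟩) (norm_nonneg c)

/-- The norm `‖f‖ = sup_x ∫ |f| dα^x` on `𝒞_c(Y)`. -/
def FullContinuousSystem.seminorm [T1Space X] (α : FullContinuousSystem π) :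
    Seminorm ℂ (CcL1 α) :=
  Seminorm.of (fun f => ⨆ x : X, ∫ y, ‖f y‖ ∂(α.fibreMeasure x))
    (by
      intro f g
      refine Real.iSup_le (fun x => ?_) (add_nonneg
        (Real.iSup_nonneg fun x => integral_nonneg fun y => norm_nonneg _)
        (Real.iSup_nonneg fun x => integral_nonneg fun y => norm_nonneg _))
      refine le_trans ?_ (add_le_add (le_ciSup (α.bddAbove f.2) x) (le_ciSup (α.bddAbove g.2) x))
      rw [← integral_add (α.integrable f.2 x).norm (α.integrable g.2 x).norm]
      exact integral_mono ((α.integrable f.2 x).add (α.integrable g.2 x)).norm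
        ((α.integrable f.2 x).norm.add (α.integrable g.2 x).norm) fun y => norm_add_le _ _)
    (by
      intro c f
      rw [Real.mul_iSup_of_nonneg (norm_nonneg c)]
      refine congrArg _ (funext fun x => ?_)
      rw [← integral_const_mul]
      exact integral_congr_ae (Eventually.of_forall fun y => norm_smul c (f y)))

instance [T1Space X] (α : FullContinuousSystem π) : SeminormedAddCommGroup (CcL1 α) :=
  α.seminorm.toAddGroupSeminorm.toSeminormedAddCommGroup

instance [T1Space X] (α : FullContinuousSystem π) : NormedSpace ℂ (CcL1 α) where
  norm_smul_le c f := (map_smul_eq_mul α.seminorm c f).le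

/-- The Banach space `C_0(X, L^1(Y, α))`: the completion of `𝒞_c(Y)` for the norm
`‖f‖ = sup_x ∫ |f| dα^x`. -/
abbrev C0L1 [T1Space X] (α : FullContinuousSystem π) : Type _ :=
  UniformSpace.Completion (CcL1 α)

end System

section Radon

variable {Y : Type*} [TopologicalSpace Y] [MeasurableSpace Y]

/-- The Borel sets contained in compact subsets of `Y`. -/
def IsBoundedBorel (B : Set Y) : Prop :=
  MeasurableSet B ∧ ∃ K : Set Y, IsCompact K ∧ B ⊆ K

/-- `ν` is a complex Borel Radon measure: a complex set function on the Borel sets contained in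
compact sets which is countably additive and inner regular. The values of `ν` on other sets
are irrelevant. -/
structure IsComplexBorelRadon (ν : Set Y → ℂ) : Prop where
  hasSum_iUnion : ∀ B : ℕ → Set Y, (∀ n, MeasurableSet (B n)) →
    Pairwise (Function.onFun Disjoint B) → IsBoundedBorel (⋃ n, B n) →
    HasSum (fun n => ν (B n)) (ν (⋃ n, B n))
  innerRegular : ∀ B : Set Y, IsBoundedBorel B → ∀ ε : ℝ, 0 < ε →
    ∃ C : Set Y, C ⊆ B ∧ IsCompact C ∧ MeasurableSet C ∧
      ∀ A : Set Y, MeasurableSet A → A ⊆ B \ C → ‖ν A‖ < ε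

variable {X : Type*} [TopologicalSpace X] [MeasurableSpace X] {π : C(Y, X)}

/-- The equality `ν = φ (μ ∘ α)` of complex Borel Radon measures. -/
def EqDensity (α : FullContinuousSystem π) (ν : Set Y → ℂ) (μ : Measure X)
    (φ : Lp ℂ ∞ (α.comp μ)) : Prop :=
  ∀ B : Set Y, IsBoundedBorel B → ν B = ∫ y in B, φ y ∂(α.comp μ)

variable [BorelSpace Y] [T1Space X]

/-- The continuous linear form `Φ` is integration against the measure `φ (μ ∘ α)`. -/
def IsIntegrationAgainst (α : FullContinuousSystem π) (Φ : StrongDual ℂ (C0L1 α)) (μ : Measure X)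
    (φ : Lp ℂ ∞ (α.comp μ)) : Prop :=
  ∀ f : CcL1 α, Φ (f : C0L1 α) = ∫ y, f y * φ y ∂(α.comp μ)

end Radon

end FibredMeasure

end

open FibredMeasure

/-! The core is a domination principle. Given a form `Φ` on `𝒞_c(Y)`, let `Λ(h)`, for `h ≥ 0` in
`C_c(X)`, be the supremum of `|Φ(f)|` over all `f` with `∫ |f| dα^x ≤ h(x)` for every `x`.
Multiplying `f` by functions pulled back from `X` shows that `Λ` is subadditive, and multiplying by
phases that it is superadditive (`dominatedSup_add`), so Riesz's theorem turns `Λ` into a finite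
regular measure `μ` on `X`. Its mass is at most `‖Φ‖`, since `h ≤ 1` forces `Λ(h) ≤ ‖Φ‖`. If `f`
lies in some `C_c(U)`, then `x ↦ ∫ |f| dα^x` is itself in `C_c(X)`, whence `|Φ(f)| ≤ ∫ |f| d(μ ∘ α)`
(`exists_dominating_measure`). Duality of `L¹` gives densities bounded by `1` on small open sets,
and these glue to one `φ` (`exists_density`). As conversely every representation gives `‖Φ‖ ≤ μ(X)
‖φ‖`, the infimum is attained.

To compare two representations, both are written as densities with respect to `(μ + μ') ∘ α`.
Equality of the forms and equality of the set functions then each say that the difference of the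
densities vanishes almost everywhere (`forall_integral_eq_iff`).

Since `Y` need not be Hausdorff, the measure theory is done on Hausdorff open sets with `α^x(U)`
bounded in `x`, countably many of which cover `Y`. There `μ ∘ α` is finite; its regularity is not
automatic, because `Y` need not be second countable. It follows from the regularity of each `α^x`
and the `τ`-additivity of `μ`, which exchanges an uncountable directed supremum with `∫ dμ`. -/

open scoped NNReal

set_option linter.unusedSectionVars false

/-! ### Finite measures: `τ`-additivity, regularity, the dual of `L¹`. -/

/-- A finite regular measure is `τ`-additive: it commutes with suprema of uniformly bounded directed
families of lower semicontinuous functions. -/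
theorem MeasureTheory.lintegral_iSup_directed_lowerSemicontinuous {X ι : Type*} [TopologicalSpace X]
    [T2Space X] [MeasurableSpace X] [BorelSpace X] (μ : Measure X) [IsFiniteMeasure μ] [μ.Regular]
    [Nonempty ι] {h : ι → X → ℝ≥0∞} (hl : ∀ i, LowerSemicontinuous (h i)) (hd : Directed (· ≤ ·) h)
    {M : ℝ≥0} (hM : ∀ i x, h i x ≤ M) :
    ∫⁻ x, ⨆ i, h i x ∂μ = ⨆ i, ∫⁻ x, h i x ∂μ := by
  refine le_antisymm ?_ (iSup_le fun i => lintegral_mono fun x => le_iSup (fun i => h i x) i)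
  have hGM : ∀ x, ⨆ i, h i x ≤ M := fun x => iSup_le fun i => hM i x
  have hGt : ∀ x, ⨆ i, h i x ≠ ∞ := fun x => ((hGM x).trans_lt ENNReal.coe_lt_top).ne
  set G : X → ℝ≥0 := fun x => (⨆ i, h i x).toNNReal with hG
  have hGe : ∀ x, (G x : ℝ≥0∞) = ⨆ i, h i x := fun x => ENNReal.coe_toNNReal (hGt x)
  have hfin : ∫⁻ x, G x ∂μ ≠ ∞ := by
    refine ((lintegral_mono fun x => ?_).trans_lt
      (show ∫⁻ _, (M : ℝ≥0∞) ∂μ < ∞ from ?_)).ne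
    · rw [hGe]; exact hGM x
    · rw [lintegral_const]
      exact ENNReal.mul_lt_top ENNReal.coe_lt_top (measure_lt_top _ _)
  have key : ∀ ε : ℝ≥0, 0 < ε →
      ∫⁻ x, ⨆ i, h i x ∂μ ≤ (⨆ i, ∫⁻ x, h i x ∂μ) + ε * (μ univ + M + 1) := by
    intro ε hε
    have hε' : (ε : ℝ≥0∞) ≠ 0 := by exact_mod_cast hε.ne'
    -- Vitali–Carathéodory: with `g` upper semicontinuous and `h i` lower semicontinuous, the sets
    -- `{g < h i + ε}` are open and directed, so a single one contains `K`. The slack `ε` makes the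
    -- inequality strict, hence a cover.
    obtain ⟨g, hgG, hgu, hgi⟩ := exists_upperSemicontinuous_le_lintegral_le G hfin hε'
    obtain ⟨K, -, hK, hKm⟩ := MeasurableSet.univ.exists_isCompact_lt_add (measure_ne_top μ univ) hε'
    have hKc : μ Kᶜ ≤ ε := by
      rw [measure_compl hK.measurableSet (measure_ne_top _ _)]
      exact tsub_le_iff_left.2 hKm.le
    obtain ⟨i, hi⟩ : ∃ i, K ⊆ {x | (g x : ℝ≥0∞) < h i x + ε} := by
      refine hK.elim_directed_cover _ (fun i => ?_) (fun x hx => ?_) ?_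
      · rw [isOpen_iff_mem_nhds]
        intro x hx
        obtain ⟨t, ht1, ht2⟩ := ENNReal.lt_iff_exists_nnreal_btwn.1 hx
        have h2 := ((hl i).add (g := fun _ => (ε : ℝ≥0∞)) lowerSemicontinuous_const) x t ht2
        filter_upwards [hgu x t (by exact_mod_cast ht1), h2] with y hy1 hy2
        exact lt_trans (by exact_mod_cast hy1) hy2
      · have h1 : (g x : ℝ≥0∞) < (⨆ i, h i x) + ε := by
          refine lt_of_le_of_lt ?_ (ENNReal.lt_add_right (hGt x) hε')
          rw [← hGe]; exact ENNReal.coe_le_coe.2 (hgG x)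
        rw [ENNReal.iSup_add] at h1
        exact mem_iUnion.2 (lt_iSup_iff.1 h1)
      · exact hd.mono_comp _ (g := fun f : X → ℝ≥0∞ => {x | (g x : ℝ≥0∞) < f x + ε})
          fun f f' hff x hx => lt_of_lt_of_le hx (add_le_add_left (hff x) _)
    have hgK : ∫⁻ x, g x ∂μ ≤ ∫⁻ x, h i x ∂μ + ε * μ univ + M * ε := by
      rw [← lintegral_add_compl _ hK.measurableSet]
      refine add_le_add ?_ ?_
      · calc ∫⁻ x in K, g x ∂μ ≤ ∫⁻ x in K, (h i x + ε) ∂μ :=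
              setLIntegral_mono' hK.measurableSet fun x hx => (hi hx).le
          _ ≤ ∫⁻ x, (h i x + ε) ∂μ := setLIntegral_le_lintegral _ _
          _ = _ := by rw [lintegral_add_right _ measurable_const, lintegral_const]
      · calc ∫⁻ x in Kᶜ, g x ∂μ ≤ ∫⁻ x in Kᶜ, M ∂μ := by
              refine lintegral_mono fun x => ?_
              refine le_trans ?_ (hGM x)
              rw [← hGe]; exact ENNReal.coe_le_coe.2 (hgG x)
          _ = M * μ Kᶜ := by rw [setLIntegral_const]
          _ ≤ _ := by gcongr
    calc ∫⁻ x, ⨆ i, h i x ∂μ = ∫⁻ x, G x ∂μ := by simp only [hGe]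
      _ ≤ ∫⁻ x, h i x ∂μ + ε * μ univ + M * ε + ε := hgi.trans (by gcongr)
      _ = ∫⁻ x, h i x ∂μ + ε * (μ univ + M + 1) := by ring
      _ ≤ _ := by gcongr; exact le_iSup (fun i => ∫⁻ x, h i x ∂μ) i
  have hlim : Tendsto (fun ε : ℝ≥0 => (⨆ i, ∫⁻ x, h i x ∂μ) + (ε : ℝ≥0∞) * (μ univ + M + 1))
      (𝓝[>] 0) (𝓝 ((⨆ i, ∫⁻ x, h i x ∂μ) + (0 : ℝ≥0) * (μ univ + M + 1))) := by
    refine (Tendsto.const_add _ (ENNReal.Tendsto.mul_const ?_ (Or.inr ?_))).mono_left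
      nhdsWithin_le_nhds
    · exact ENNReal.tendsto_coe.2 tendsto_id
    · exact ENNReal.add_ne_top.2 ⟨ENNReal.add_ne_top.2 ⟨measure_ne_top _ _, ENNReal.coe_ne_top⟩,
        ENNReal.one_ne_top⟩
  simp only [ENNReal.coe_zero, zero_mul, add_zero] at hlim
  exact ge_of_tendsto hlim (eventually_mem_nhdsWithin.mono fun ε hε => key ε hε)

/-- A finite Borel measure on a Hausdorff space for which open sets are inner regular with respect
to compact sets is regular. -/
theorem MeasureTheory.Measure.Regular.of_innerRegularWRT_isCompact_isOpen {X : Type*}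
    [TopologicalSpace X] [T2Space X] [MeasurableSpace X] [BorelSpace X] {μ : Measure X}
    [IsFiniteMeasure μ] (h : μ.InnerRegularWRT IsCompact IsOpen) : μ.Regular := by
  have : μ.WeaklyRegular := Measure.InnerRegularWRT.weaklyRegular_of_finite μ
    (fun U hU r hr => by
      obtain ⟨K, hKU, hK, hr⟩ := h hU r hr
      exact ⟨K, hKU, hK.isClosed, hr⟩)
  exact { innerRegular := h }

theorem MeasureTheory.Measure.Regular.add_of_isFiniteMeasure {X : Type*} [TopologicalSpace X]
    [R1Space X] [MeasurableSpace X] [BorelSpace X] (μ ν : Measure X) [IsFiniteMeasure μ]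
    [IsFiniteMeasure ν] [μ.Regular] [ν.Regular] : (μ + ν).Regular := by
  infer_instance

/-- A continuous linear form on `L¹` of a finite measure is integration against a bounded
function. -/
theorem MeasureTheory.exists_density_of_strongDual_L1 {Ω : Type*} [MeasurableSpace Ω]
    (μ : Measure Ω) [IsFiniteMeasure μ] (Ψ : StrongDual ℂ (Ω →₁[μ] ℂ)) (hΨ : ‖Ψ‖ ≤ 1) :
    ∃ g : Ω → ℂ, Measurable g ∧ (∀ y, ‖g y‖ ≤ 1) ∧ ∀ (f : Ω → ℂ) (hf : Integrable f μ),
      MemLp f 2 μ → Ψ hf.toL1 = ∫ y, f y * g y ∂μ := by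
  have hint : ∀ F : Ω →₂[μ] ℂ, Integrable F μ := fun F => (Lp.memLp F).integrable one_le_two
  have hnorm : ∀ F : Ω →₂[μ] ℂ, ‖(hint F).toL1‖ ≤ μ.real univ ^ (1 / 2 : ℝ) * ‖F‖ := fun F => by
    rw [Integrable.norm_toL1_eq_lintegral_enorm, ← eLpNorm_one_eq_lintegral_enorm, Lp.norm_def,
      Measure.real, ENNReal.toReal_rpow, ← ENNReal.toReal_mul, mul_comm]
    refine ENNReal.toReal_mono (ENNReal.mul_ne_top (Lp.eLpNorm_ne_top F) (by finiteness)) ?_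
    convert eLpNorm_le_eLpNorm_mul_rpow_measure_univ one_le_two (Lp.aestronglyMeasurable F) using 3
    norm_num
  let J : (Ω →₂[μ] ℂ) →ₗ[ℂ] (Ω →₁[μ] ℂ) :=
    { toFun := fun F => (hint F).toL1
      map_add' := fun F G => by
        rw [← Integrable.toL1_add]
        exact (Integrable.toL1_eq_toL1_iff _ _ _ _).2 (Lp.coeFn_add F G)
      map_smul' := fun c F => by
        rw [RingHom.id_apply, ← Integrable.toL1_smul]
        exact (Integrable.toL1_eq_toL1_iff _ _ _ _).2 (Lp.coeFn_smul c F) }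
  -- The measure being finite, `L²` maps continuously to `L¹`, so the pulled back form has a Riesz
  -- representative in a Hilbert space.
  let ℓ : StrongDual ℂ (Ω →₂[μ] ℂ) := Ψ.comp (J.mkContinuous _ hnorm)
  set g₀ : Ω →₂[μ] ℂ := (InnerProductSpace.toDual ℂ _).symm ℓ with hg₀
  have hrep : ∀ (f : Ω → ℂ) (hf : Integrable f μ), MemLp f 2 μ →
      Ψ hf.toL1 = ∫ y, f y * starRingEnd ℂ (g₀ y) ∂μ := by
    intro f hf hf2
    have h1 : ℓ hf2.toLp = Ψ hf.toL1 :=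
      congrArg Ψ ((Integrable.toL1_eq_toL1_iff _ _ (hint hf2.toLp) hf).2 hf2.coeFn_toLp)
    rw [← h1, ← InnerProductSpace.toDual_symm_apply (𝕜 := ℂ) (y := ℓ), L2.inner_def]
    refine integral_congr_ae (hf2.coeFn_toLp.mono fun y hy => ?_)
    simp only [hy, RCLike.inner_apply]
    rfl
  have hg₀m : Measurable g₀ := (Lp.stronglyMeasurable g₀).measurable
  -- Testing `Ψ` on `1_A g₀` gives `∫_A |g₀|² ≤ ∫_A |g₀|`; since `|g₀|² > |g₀|` on `A`, this set is
  -- null.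
  set A : Set Ω := {y | 1 < ‖g₀ y‖} with hA
  have hAm : MeasurableSet A := measurableSet_lt measurable_const hg₀m.norm
  have hk2 : MemLp (A.indicator g₀) 2 μ := (Lp.memLp g₀).indicator hAm
  have hk1 : Integrable (A.indicator g₀) μ := hk2.integrable one_le_two
  have hsq : Integrable (A.indicator fun y => ‖g₀ y‖ ^ 2) μ :=
    ((Lp.memLp g₀).integrable_norm_pow two_ne_zero).indicator hAm
  have hle : ∫ y, A.indicator (fun y => ‖g₀ y‖ ^ 2) y ∂μ ≤ ∫ y, ‖A.indicator g₀ y‖ ∂μ := by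
    have h1 : Ψ hk1.toL1 = ((∫ y, A.indicator (fun y => ‖g₀ y‖ ^ 2) y ∂μ : ℝ) : ℂ) := by
      rw [hrep _ hk1 hk2, ← integral_complex_ofReal]
      refine integral_congr_ae (Eventually.of_forall fun y => ?_)
      by_cases hy : y ∈ A
      · simp [hy, Complex.mul_conj, Complex.normSq_eq_norm_sq]
      · simp [hy]
    have h2 : ‖Ψ hk1.toL1‖ ≤ ‖hk1.toL1‖ :=
      (Ψ.le_opNorm _).trans (mul_le_of_le_one_left (norm_nonneg _) hΨ)
    rw [h1, Complex.norm_real, L1.norm_eq_integral_norm] at h2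
    refine (le_abs_self _).trans (h2.trans_eq ?_)
    exact integral_congr_ae (hk1.coeFn_toL1.mono fun y hy => by simp only [hy])
  have hdiff : (fun y => A.indicator (fun y => ‖g₀ y‖ ^ 2) y - ‖A.indicator g₀ y‖) =ᵐ[μ] 0 := by
    refine (integral_eq_zero_iff_of_nonneg (fun y => ?_) (hsq.sub hk1.norm)).1
      (le_antisymm ?_ (integral_nonneg fun y => ?_))
    rotate_left
    · rw [integral_sub' hsq hk1.norm]; linarith
    all_goals
      by_cases hy : y ∈ A
      · have : 1 < ‖g₀ y‖ := hy
        simp only [hy, indicator_of_mem, Pi.zero_apply, Pi.sub_apply]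
        nlinarith
      · simp [hy]
  have hae : ∀ᵐ y ∂μ, y ∉ A := hdiff.mono fun y hy hyA => by
    have : 1 < ‖g₀ y‖ := hyA
    simp only [hyA, indicator_of_mem, Pi.zero_apply] at hy
    nlinarith
  refine ⟨Aᶜ.indicator fun y => starRingEnd ℂ (g₀ y),
    (Complex.continuous_conj.measurable.comp hg₀m).indicator hAm.compl, fun y => ?_,
    fun f hf hf2 => (hrep f hf hf2).trans (integral_congr_ae (hae.mono fun y hy => ?_))⟩
  · by_cases hy : y ∈ A
    · simp [hy]
    · simpa [hy] using not_lt.1 hy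
  · simp [hy]

/-! ### Density and duality for `C_c` of a locally compact Hausdorff space. -/

section CompactlySupported

open scoped CompactlySupported

variable {Ω : Type*} [TopologicalSpace Ω] [MeasurableSpace Ω] [BorelSpace Ω] (μ : Measure Ω)
  [IsFiniteMeasure μ]

theorem CompactlySupportedContinuousMap.memLp_of_isFiniteMeasure (f : C_c(Ω, ℂ)) (p : ℝ≥0∞) :
    MemLp f p μ :=
  f.continuous.memLp_of_hasCompactSupport f.hasCompactSupport

variable [T2Space Ω] [LocallyCompactSpace Ω]

/-- In a locally compact Hausdorff space, compactly supported continuous functions approximate the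
functions of `ℒp` for `p < ∞`, for every finite regular measure. -/
theorem MeasureTheory.MemLp.exists_compactlySupported_eLpNorm_sub_le [μ.Regular] {p : ℝ≥0∞}
    (hp : p ≠ ∞) {f : Ω → ℂ} (hf : MemLp f p μ) {ε : ℝ≥0∞} (hε : ε ≠ 0) :
    ∃ g : C_c(Ω, ℂ), eLpNorm (f - ⇑g) p μ ≤ ε := by
  suffices H : ∃ g : Ω → ℂ, eLpNorm (f - g) p μ ≤ ε ∧ Continuous g ∧ HasCompactSupport g by
    obtain ⟨g, hg, hgc, hgs⟩ := H
    exact ⟨⟨⟨g, hgc⟩, hgs⟩, hg⟩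
  refine hf.induction_dense hp _ ?_ ?_ ?_ hε
  · intro c t ht _ ε hε
    -- The Urysohn approximation differs from the indicator of `t` only on `V \ K`, by at most
    -- `‖c‖`, so `η` bounds the measure allowed for `V \ K`.
    obtain ⟨η, hη, hηε⟩ := exists_eLpNorm_indicator_le hp c (μ := μ) hε
    have hη2 : (η / 2 : ℝ≥0∞) ≠ 0 := by simpa using hη.ne'
    obtain ⟨K, hKt, hK, hKm⟩ :=
      ht.exists_isCompact_sdiff_lt (measure_ne_top μ t) hη2
    obtain ⟨V, htV, hV, -, hVm⟩ := ht.exists_isOpen_sdiff_lt (measure_ne_top μ t) hη2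
    have hVK : μ (V \ K) ≤ η := by
      calc μ (V \ K) ≤ μ (V \ t ∪ t \ K) := measure_mono fun y hy => by
            by_cases hyt : y ∈ t
            · exact Or.inr ⟨hyt, hy.2⟩
            · exact Or.inl ⟨hy.1, hyt⟩
        _ ≤ η / 2 + η / 2 := (measure_union_le _ _).trans (add_le_add hVm.le hKm.le)
        _ = η := ENNReal.add_halves _
    obtain ⟨g, hgK, hgV, hgc, hg01⟩ := exists_continuous_one_zero_of_isCompact hK
      hV.isClosed_compl (disjoint_left.2 fun y hy hyV => hyV (htV (hKt hy)))
    refine ⟨fun y => (g y : ℂ) * c, le_trans (eLpNorm_mono fun y => ?_) (hηε _ hVK),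
      by fun_prop, ?_⟩
    · obtain ⟨h0, h1⟩ := hg01 y
      by_cases hyK : y ∈ K
      · simp [hgK hyK, hKt hyK]
      by_cases hyV : y ∈ V
      · rw [indicator_of_mem (show y ∈ V \ K from ⟨hyV, hyK⟩)]
        by_cases hyt : y ∈ t
        · have : (g y : ℂ) * c - c = ((g y - 1 : ℝ) : ℂ) * c := by push_cast; ring
          simp only [Pi.sub_apply, hyt, indicator_of_mem, this, norm_mul, Complex.norm_real]
          refine mul_le_of_le_one_left (norm_nonneg _) (abs_le.2 ⟨by linarith, by linarith⟩)
        · simp only [Pi.sub_apply, hyt, not_false_eq_true, indicator_of_notMem, sub_zero, norm_mul,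
            Complex.norm_real]
          exact mul_le_of_le_one_left (norm_nonneg _) (abs_le.2 ⟨by linarith, by linarith⟩)
      · have hyt : y ∉ t := fun h => hyV (htV h)
        simp [hgV hyV, hyt]
    · have : HasCompactSupport fun y => (g y : ℂ) := hgc.comp_left (g := ((↑) : ℝ → ℂ)) rfl
      exact this.mul_right
  · exact fun f g hf hg => ⟨hf.1.add hg.1, hf.2.add hg.2⟩
  · exact fun f hf => hf.1.aestronglyMeasurable

/-- On a regular finite measure space, a linear form on `C_c` which is bounded by the `L¹` norm is
integration against a function bounded by `1`. -/
theorem CompactlySupportedContinuousMap.exists_density_of_le_integral_norm [μ.Regular]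
    (Φ : C_c(Ω, ℂ) →ₗ[ℂ] ℂ) (hΦ : ∀ f, ‖Φ f‖ ≤ ∫ y, ‖f y‖ ∂μ) :
    ∃ g : Ω → ℂ, Measurable g ∧ (∀ y, ‖g y‖ ≤ 1) ∧ ∀ f : C_c(Ω, ℂ), Φ f = ∫ y, f y * g y ∂μ := by
  have hint : ∀ f : C_c(Ω, ℂ), Integrable f μ := fun f =>
    memLp_one_iff_integrable.1 (f.memLp_of_isFiniteMeasure μ 1)
  let T : C_c(Ω, ℂ) →ₗ[ℂ] (Ω →₁[μ] ℂ) :=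
    { toFun := fun f => (hint f).toL1
      map_add' := fun f g => Integrable.toL1_add _ _ _ _
      map_smul' := fun c f => Integrable.toL1_smul f (hint f) c }
  have hT : DenseRange T := by
    intro F
    rw [EMetric.mem_closure_iff]
    intro ε hε
    obtain ⟨δ, hδ, hδε⟩ := exists_between hε
    obtain ⟨f, hf⟩ :=
      (Lp.memLp F).exists_compactlySupported_eLpNorm_sub_le μ ENNReal.one_ne_top hδ.ne'
    refine ⟨_, ⟨f, rfl⟩, lt_of_le_of_lt ?_ hδε⟩
    rw [Lp.edist_def]
    refine le_trans (le_of_eq (eLpNorm_congr_ae ?_)) hf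
    exact (ae_eq_refl F).sub (hint f).coeFn_toL1
  -- This bound makes `Φ` factor through the dense range of `T`, even where `T` is not injective.
  have hbd : ∀ f, ‖Φ f‖ ≤ 1 * ‖T f‖ := fun f => by
    rw [one_mul, L1.norm_eq_integral_norm]
    refine (hΦ f).trans_eq (integral_congr_ae ((hint f).coeFn_toL1.mono fun y hy => ?_))
    exact congrArg norm hy.symm
  obtain ⟨g, hg, hg1, hgi⟩ := exists_density_of_strongDual_L1 μ (Φ.extendOfNorm T)
    (LinearMap.opNorm_extendOfNorm_le hT zero_le_one hbd)
  refine ⟨g, hg, hg1, fun f => ?_⟩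
  rw [← hgi f (hint f) (f.memLp_of_isFiniteMeasure μ 2)]
  exact (LinearMap.extendOfNorm_eq hT ⟨1, hbd⟩ f).symm

/-- A square integrable function which is orthogonal to all compactly supported continuous functions
vanishes almost everywhere. -/
theorem CompactlySupportedContinuousMap.ae_eq_zero_of_integral_mul_eq_zero [μ.Regular]
    {g : Ω → ℂ} (hg : MemLp g 2 μ) (h : ∀ f : C_c(Ω, ℂ), ∫ y, f y * g y ∂μ = 0) :
    g =ᵐ[μ] 0 := by
  have hg' : MemLp (fun y => starRingEnd ℂ (g y)) 2 μ := hg.star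
  have hz : hg'.toLp = 0 := by
    refine DenseRange.eq_zero_of_inner_left ℂ (f := fun f : C_c(Ω, ℂ) =>
      (f.memLp_of_isFiniteMeasure μ 2).toLp f) (fun F => ?_) (fun f => ?_)
    · rw [EMetric.mem_closure_iff]
      intro ε hε
      obtain ⟨δ, hδ, hδε⟩ := exists_between hε
      obtain ⟨f, hf⟩ :=
        (Lp.memLp F).exists_compactlySupported_eLpNorm_sub_le μ ENNReal.ofNat_ne_top hδ.ne'
      refine ⟨_, ⟨f, rfl⟩, lt_of_le_of_lt ?_ hδε⟩
      rw [Lp.edist_def]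
      refine le_trans (le_of_eq (eLpNorm_congr_ae ?_)) hf
      exact (ae_eq_refl F).sub (MemLp.coeFn_toLp _)
    · rw [L2.inner_def, ← h f]
      refine integral_congr_ae ?_
      filter_upwards [hg'.coeFn_toLp, (f.memLp_of_isFiniteMeasure μ 2).coeFn_toLp] with y h1 h2
      simp [h1, h2]
  filter_upwards [hg'.coeFn_toLp, (Lp.eq_zero_iff_ae_eq_zero.1 hz)] with y h1 h2
  simpa [h2] using h1.symm

end CompactlySupported

namespace FibredMeasure

open scoped CompactlySupported

/-! ### Extension by zero from Hausdorff open sets. -/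

section ExtensionByZero

variable {Y : Type*} [TopologicalSpace Y]

theorem t2Space_of_subset {U V : Set Y} (hVU : V ⊆ U) [T2Space U] : T2Space V :=
  T2Space.of_injective_continuous (inclusion_injective hVU) (continuous_inclusion hVU)

theorem continuousOn_extend_and_exists_isCompact {U : Set Y} (f : C_c(U, ℂ)) :
    ContinuousOn (Function.extend Subtype.val f 0) U ∧ ∃ K : Set Y, IsCompact K ∧ K ⊆ U ∧
      ∀ y, y ∉ K → Function.extend Subtype.val f 0 y = 0 := by
  have hval : ∀ y : U, Function.extend Subtype.val f 0 (y : Y) = f y :=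
    fun y => Subtype.val_injective.extend_apply _ _ _
  refine ⟨?_, Subtype.val '' tsupport f,
    f.hasCompactSupport.isCompact.image continuous_subtype_val, ?_, fun y hy => ?_⟩
  · rw [continuousOn_iff_continuous_domRestrict]
    convert f.continuous using 1
    exact funext hval
  · rintro _ ⟨y, -, rfl⟩
    exact y.2
  · by_cases h : y ∈ U
    · rw [hval ⟨y, h⟩]
      by_contra hne
      exact hy ⟨⟨y, h⟩, subset_tsupport _ hne, rfl⟩
    · exact Function.extend_apply' _ _ _ (by rintro ⟨a, rfl⟩; exact h a.2)

theorem isExtensionByZero_extend {U : Set Y} (hU : IsOpen U) [T2Space U] (f : C_c(U, ℂ)) :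
    IsExtensionByZero (Function.extend Subtype.val f 0) :=
  ⟨U, hU, inferInstance, continuousOn_extend_and_exists_isCompact f⟩

/-- The extension by zero of a compactly supported continuous function is continuous on every larger
Hausdorff set. -/
theorem continuousOn_of_isCompact {f : Y → ℂ} {U W K : Set Y} [T2Space U] (hW : IsOpen W)
    (hf : ContinuousOn f W) (hK : IsCompact K) (hKU : K ⊆ U) (hKW : K ⊆ W)
    (h0 : ∀ y, y ∉ K → f y = 0) : ContinuousOn f U := by
  -- `K` need not be closed in `Y`, but it is closed in the Hausdorff set `U`; off `K` the function
  -- is then locally zero in `U`.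
  have hK' : IsCompact ((Subtype.val : U → Y) ⁻¹' K) := by
    rw [Topology.IsInducing.subtypeVal.isCompact_preimage_iff (by simpa using hKU)]
    exact hK
  rw [continuousOn_iff_continuous_domRestrict, continuous_iff_continuousAt]
  intro y
  by_cases hy : (y : Y) ∈ K
  · exact (hf.continuousAt (hW.mem_nhds (hKW hy))).comp continuous_subtype_val.continuousAt
  · refine (continuousAt_const (y := (0 : ℂ))).congr ?_
    filter_upwards [hK'.isClosed.isOpen_compl.mem_nhds hy] with z hz
    exact (h0 z hz).symm

theorem IsExtensionByZero.exists_extend_eq {f : Y → ℂ} {U K : Set Y} [T2Space U]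
    (hf : ContinuousOn f U) (hK : IsCompact K) (hKU : K ⊆ U) (h0 : ∀ y, y ∉ K → f y = 0) :
    ∃ g : C_c(U, ℂ), Function.extend Subtype.val g 0 = f := by
  have hK' : IsCompact ((Subtype.val : U → Y) ⁻¹' K) := by
    rw [Topology.IsInducing.subtypeVal.isCompact_preimage_iff (by simpa using hKU)]
    exact hK
  refine ⟨⟨⟨U.domRestrict f, continuousOn_iff_continuous_domRestrict.1 hf⟩,
    HasCompactSupport.intro hK' fun y hy => h0 y hy⟩, funext fun y => ?_⟩
  by_cases h : y ∈ U
  · exact Subtype.val_injective.extend_apply _ _ (⟨y, h⟩ : U)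
  · rw [Function.extend_apply' _ _ _ (by rintro ⟨a, rfl⟩; exact h a.2), h0 y fun hy => h (hKU hy)]
    rfl

theorem Cc.measurable [MeasurableSpace Y] [BorelSpace Y] {f : Y → ℂ} (hf : f ∈ Cc Y) :
    Measurable f := by
  induction hf using Submodule.span_induction with
  | mem f hf => exact hf.measurable
  | zero => exact measurable_const
  | add f g _ _ hf hg => exact hf.add hg
  | smul c f _ hf => exact hf.const_smul c

theorem Cc.mul_continuous {f : Y → ℂ} (hf : f ∈ Cc Y) {k : Y → ℂ} (hk : Continuous k) :
    (fun y => k y * f y) ∈ Cc Y := by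
  induction hf using Submodule.span_induction with
  | mem f hf =>
    obtain ⟨U, hU, hT, hc, K, hK, hKU, h0⟩ := hf
    exact Submodule.subset_span ⟨U, hU, hT, hk.continuousOn.mul hc, K, hK, hKU,
      fun y hy => by simp [h0 y hy]⟩
  | zero => simp [← Pi.zero_def]
  | add f g _ _ hf hg => simpa [mul_add] using! (Cc Y).add_mem hf hg
  | smul c f _ hf => simpa [mul_left_comm] using! (Cc Y).smul_mem c hf

end ExtensionByZero

/-! ### Finiteness and regularity of `μ ∘ α`. -/

section Comp

variable {X Y : Type*} [TopologicalSpace X] [T2Space X] [TopologicalSpace Y] [MeasurableSpace Y]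
  [BorelSpace Y] {π : C(Y, X)}

theorem FullContinuousSystem.integral_norm_le (α : FullContinuousSystem π) (f : CcL1 α) (x : X) :
    ∫ y, ‖f y‖ ∂(α.fibreMeasure x) ≤ ‖f‖ :=
  le_ciSup (α.bddAbove f.2) x

theorem FullContinuousSystem.norm_le (α : FullContinuousSystem π) (f : CcL1 α) {C : ℝ}
    (hC : 0 ≤ C) (h : ∀ x, ∫ y, ‖f y‖ ∂(α.fibreMeasure x) ≤ C) : ‖f‖ ≤ C :=
  Real.iSup_le h hC

theorem FullContinuousSystem.lintegral_enorm_onTotal (α : FullContinuousSystem π) {f : Y → ℂ}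
    (hf : f ∈ Cc Y) (x : X) :
    ∫⁻ y, ‖f y‖ₑ ∂(α.onTotal x) = ENNReal.ofReal (∫ y, ‖f y‖ ∂(α.fibreMeasure x)) := by
  rw [ofReal_integral_norm_eq_lintegral_enorm (α.integrable hf x), onTotal,
    lintegral_map (Cc.measurable hf).enorm measurable_subtype_coe]

/-- A Hausdorff open set on which the measures `α^x` are uniformly bounded. -/
structure FullContinuousSystem.IsUniformlyFinite (α : FullContinuousSystem π) (U : Set Y) :
    Prop where
  isOpen : IsOpen U
  t2Space : T2Space U
  bound : ∃ M : ℝ≥0, ∀ x, α.onTotal x U ≤ M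

theorem FullContinuousSystem.IsUniformlyFinite.mono {α : FullContinuousSystem π} {U V : Set Y}
    (hU : α.IsUniformlyFinite U) (hV : IsOpen V) (hVU : V ⊆ U) : α.IsUniformlyFinite V := by
  obtain ⟨M, hM⟩ := hU.bound
  have := hU.t2Space
  exact ⟨hV, t2Space_of_subset hVU, M, fun x => (measure_mono hVU).trans (hM x)⟩

/-- The measure of an open set is approximated by that of its relatively compact open subsets. -/
theorem FullContinuousSystem.onTotal_eq_iSup (α : FullContinuousSystem π)
    (hY : LocallyCompactLocallyHausdorff Y) {W : Set Y} (hW : IsOpen W) [T2Space W] (x : X) :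
    α.onTotal x W = ⨆ V : {V : Set Y // IsOpen V ∧ ∃ C, IsCompact C ∧ V ⊆ C ∧ C ⊆ W},
      α.onTotal x V.1 := by
  refine le_antisymm (le_of_forall_lt fun r hr => ?_)
    (iSup_le fun ⟨V, _, C, _, hVC, hCW⟩ => measure_mono (hVC.trans hCW))
  have := hY.locallyCompactSpace hW
  have := α.regular x
  rw [α.onTotal_apply _ hW.measurableSet] at hr
  obtain ⟨C, hCW, hC, hrC⟩ := (hW.preimage continuous_subtype_val).exists_lt_isCompact hr
  have hC' : IsCompact ((Subtype.val : W → Y) ⁻¹' (Subtype.val '' C)) := by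
    rw [Topology.IsInducing.subtypeVal.isCompact_preimage_iff (by simpa using hCW)]
    exact hC.image continuous_subtype_val
  obtain ⟨L, hL, hCL⟩ := exists_compact_superset hC'
  have hVo : IsOpen (Subtype.val '' interior L) := hW.isOpenMap_subtype_val _ isOpen_interior
  refine hrC.trans_le (le_trans ?_ (le_iSup
    (fun V : {V : Set Y // IsOpen V ∧ ∃ C, IsCompact C ∧ V ⊆ C ∧ C ⊆ W} => α.onTotal x V.1)
    ⟨Subtype.val '' interior L, hVo, Subtype.val '' L, hL.image continuous_subtype_val,
      image_mono interior_subset, by rintro _ ⟨u, -, rfl⟩; exact u.2⟩))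
  rw [α.onTotal_apply _ hVo.measurableSet]
  refine measure_mono fun z hz => ?_
  exact ⟨⟨z, hCW hz⟩, hCL ⟨z, hz, rfl⟩, rfl⟩

/-- If `g` in `C_c(U)` equals `1` at `y`, then `V = {g > 1/2}` satisfies `α^x(V) ≤ ∫ 2|g| dα^x ≤
2‖g‖` for all `x`. -/
theorem FullContinuousSystem.exists_isUniformlyFinite (α : FullContinuousSystem π)
    (hY : LocallyCompactLocallyHausdorff Y) (y : Y) :
    ∃ V, α.IsUniformlyFinite V ∧ y ∈ V ∧ ∃ K, IsCompact K ∧ V ⊆ K := by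
  obtain ⟨K, hK, hKc, hKT⟩ := hY y
  set U := interior K with hU
  have hyU : y ∈ U := mem_interior_iff_mem_nhds.2 hK
  have hUT : T2Space U := t2Space_of_subset interior_subset
  have hlc := hY.locallyCompactSpace (isOpen_interior : IsOpen U)
  obtain ⟨g, hg1, -, hgc, hg01⟩ := exists_continuous_one_zero_of_isCompact
    (isCompact_singleton (x := (⟨y, hyU⟩ : U))) isClosed_empty (disjoint_empty _)
  have hgc' : HasCompactSupport fun u => (g u : ℂ) := hgc.comp_left (g := ((↑) : ℝ → ℂ)) rfl
  let F : C_c(U, ℂ) := ⟨⟨fun u => g u, by fun_prop⟩, hgc'⟩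
  have hFb := isExtensionByZero_extend isOpen_interior F
  let F' : CcL1 α := ⟨_, Submodule.subset_span hFb⟩
  have hFv : ∀ u : U, F' u = g u := fun u => Subtype.val_injective.extend_apply _ _ _
  set V : Set Y := Subtype.val '' {u : U | 1 / 2 < g u} with hV
  have hVo : IsOpen V :=
    isOpen_interior.isOpenMap_subtype_val _ (isOpen_lt continuous_const g.continuous)
  have hVU : V ⊆ U := by rintro _ ⟨u, -, rfl⟩; exact u.2
  refine ⟨V, ⟨hVo, t2Space_of_subset hVU, (2 * ‖F'‖).toNNReal, fun x => ?_⟩,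
    ⟨⟨y, hyU⟩, ?_, rfl⟩, K, hKc, hVU.trans interior_subset⟩
  · have h2 : ∫⁻ y, ‖(2 : ℂ) * F' y‖ₑ ∂(α.onTotal x) ≤ ENNReal.ofReal (2 * ‖F'‖) := by
      have := α.lintegral_enorm_onTotal ((2 : ℂ) • F').2 x
      refine this.trans_le (ENNReal.ofReal_le_ofReal ((α.integral_norm_le _ x).trans ?_))
      rw [norm_smul]; simp
    refine le_trans ?_ h2
    rw [← lintegral_indicator_one hVo.measurableSet]
    refine lintegral_mono fun z => ?_
    by_cases hz : z ∈ V
    · obtain ⟨u, hu, rfl⟩ := hz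
      have hu' : 1 / 2 < g u := hu
      rw [indicator_of_mem (show (u : Y) ∈ V from ⟨u, hu, rfl⟩), hFv, Pi.one_apply, enorm_eq_nnnorm]
      rw [ENNReal.one_le_coe_iff, ← NNReal.coe_le_coe]
      simp only [NNReal.coe_one, coe_nnnorm, norm_mul, Complex.norm_real, Complex.norm_ofNat]
      rw [Real.norm_of_nonneg (by linarith)]
      linarith
    · simp [hz]
  · have := hg1 (mem_singleton _)
    simp only [mem_ofPred_eq, this, Pi.one_apply]
    norm_num

variable [MeasurableSpace X] [BorelSpace X] [SigmaCompactSpace Y]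

theorem FullContinuousSystem.lintegral_enorm_comp (α : FullContinuousSystem π)
    (hY : LocallyCompactLocallyHausdorff Y) (μ : Measure X) {f : Y → ℂ} (hf : f ∈ Cc Y) :
    ∫⁻ y, ‖f y‖ₑ ∂(α.comp μ) = ∫⁻ x, ENNReal.ofReal (∫ y, ‖f y‖ ∂(α.fibreMeasure x)) ∂μ := by
  rw [comp, Measure.lintegral_bind (α.measurable_onTotal hY).aemeasurable
    (Cc.measurable hf).enorm.aemeasurable]
  simp only [α.lintegral_enorm_onTotal hf]

theorem FullContinuousSystem.lintegral_enorm_comp_le (α : FullContinuousSystem π)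
    (hY : LocallyCompactLocallyHausdorff Y) (μ : Measure X) (f : CcL1 α) :
    ∫⁻ y, ‖f y‖ₑ ∂(α.comp μ) ≤ ENNReal.ofReal ‖f‖ * μ univ := by
  rw [α.lintegral_enorm_comp hY μ f.2, ← lintegral_const]
  exact lintegral_mono fun x => ENNReal.ofReal_le_ofReal (α.integral_norm_le f x)

theorem FullContinuousSystem.integrable_comp (α : FullContinuousSystem π)
    (hY : LocallyCompactLocallyHausdorff Y) (μ : Measure X) [IsFiniteMeasure μ] (f : CcL1 α) :
    Integrable f (α.comp μ) :=
  ⟨(Cc.measurable f.2).aestronglyMeasurable, (α.lintegral_enorm_comp_le hY μ f).trans_lt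
    (ENNReal.mul_lt_top ENNReal.ofReal_lt_top (measure_lt_top _ _))⟩

theorem FullContinuousSystem.integral_norm_comp_le (α : FullContinuousSystem π)
    (hY : LocallyCompactLocallyHausdorff Y) (μ : Measure X) [IsFiniteMeasure μ] (f : CcL1 α) :
    ∫ y, ‖f y‖ ∂(α.comp μ) ≤ ‖f‖ * μ.real univ := by
  rw [integral_norm_eq_lintegral_enorm (Cc.measurable f.2).aestronglyMeasurable]
  refine ENNReal.toReal_le_of_le_ofReal (by positivity) ?_
  rw [ENNReal.ofReal_mul (norm_nonneg _), Measure.real, ENNReal.ofReal_toReal (measure_ne_top _ _)]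
  exact α.lintegral_enorm_comp_le hY μ f

theorem FullContinuousSystem.comp_add (α : FullContinuousSystem π)
    (hY : LocallyCompactLocallyHausdorff Y) (μ μ' : Measure X) :
    α.comp (μ + μ') = α.comp μ + α.comp μ' := by
  ext B hB
  rw [Measure.add_apply, α.comp_apply hY _ hB, α.comp_apply hY _ hB, α.comp_apply hY _ hB,
    lintegral_add_measure]

theorem FullContinuousSystem.IsUniformlyFinite.comp_lt_top {α : FullContinuousSystem π}
    (hY : LocallyCompactLocallyHausdorff Y) {U : Set Y} (hU : α.IsUniformlyFinite U)
    (μ : Measure X) [IsFiniteMeasure μ] : α.comp μ U < ∞ := by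
  obtain ⟨M, hM⟩ := hU.bound
  rw [α.comp_apply hY _ hU.isOpen.measurableSet]
  exact ((lintegral_mono hM).trans_eq (lintegral_const _)).trans_lt
    (ENNReal.mul_lt_top ENNReal.coe_lt_top (measure_lt_top _ _))

/-- Finitely many uniformly finite neighbourhoods cover `K`. They are cut down to `U` because a
union of Hausdorff open sets need not be Hausdorff. -/
theorem FullContinuousSystem.exists_isUniformlyFinite_superset (α : FullContinuousSystem π)
    (hY : LocallyCompactLocallyHausdorff Y) {U K : Set Y} (hU : IsOpen U) [T2Space U]
    (hK : IsCompact K) (hKU : K ⊆ U) : ∃ V, α.IsUniformlyFinite V ∧ K ⊆ V ∧ V ⊆ U := by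
  suffices h : ∃ V, K ⊆ V ∧ V ⊆ U ∧ IsOpen V ∧ ∃ M : ℝ≥0, ∀ x, α.onTotal x V ≤ M by
    obtain ⟨V, hKV, hVU, hV, hM⟩ := h
    exact ⟨V, ⟨hV, t2Space_of_subset hVU, hM⟩, hKV, hVU⟩
  refine hK.induction_on (p := fun S => ∃ V, S ⊆ V ∧ V ⊆ U ∧ IsOpen V ∧
    ∃ M : ℝ≥0, ∀ x, α.onTotal x V ≤ M) ?_ ?_ ?_ ?_
  · exact ⟨∅, Subset.rfl, empty_subset _, isOpen_empty, 0, by simp⟩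
  · rintro S T hST ⟨V, hTV, hV⟩
    exact ⟨V, hST.trans hTV, hV⟩
  · rintro S T ⟨V, hSV, hVU, hV, M, hM⟩ ⟨W, hTW, hWU, hW, N, hN⟩
    refine ⟨V ∪ W, union_subset_union hSV hTW, union_subset hVU hWU, hV.union hW, M + N,
      fun x => (measure_union_le _ _).trans ?_⟩
    rw [ENNReal.coe_add]
    exact add_le_add (hM x) (hN x)
  · intro y hy
    obtain ⟨V, hV, hyV, -⟩ := α.exists_isUniformlyFinite hY y
    obtain ⟨M, hM⟩ := (hV.mono (hV.isOpen.inter hU) inter_subset_left).bound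
    exact ⟨V ∩ U, mem_nhdsWithin_of_mem_nhds ((hV.isOpen.inter hU).mem_nhds ⟨hyV, hKU hy⟩),
      V ∩ U, Subset.rfl, inter_subset_right, hV.isOpen.inter hU, M, hM⟩

theorem FullContinuousSystem.exists_cover_isUniformlyFinite (α : FullContinuousSystem π)
    (hY : LocallyCompactLocallyHausdorff Y) :
    ∃ V : ℕ → Set Y, (∀ n, α.IsUniformlyFinite (V n)) ∧ (∀ n, ∃ K, IsCompact K ∧ V n ⊆ K) ∧
      ⋃ n, V n = univ := by
  choose V hV hyV hVK using α.exists_isUniformlyFinite hY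
  rcases isEmpty_or_nonempty Y with hE | hE
  · refine ⟨fun _ => ∅, fun _ => ⟨isOpen_empty, inferInstance, 0, by simp⟩,
      fun _ => ⟨∅, isCompact_empty, Subset.rfl⟩, ?_⟩
    exact Subsingleton.elim _ _
  obtain ⟨s, hs, hcov⟩ := countable_cover_nhds_of_sigmaCompact
    (f := V) fun y => (hV y).isOpen.mem_nhds (hyV y)
  have hsne : s.Nonempty := by
    rw [nonempty_iff_ne_empty]
    rintro rfl
    simp only [mem_empty_iff_false, iUnion_of_empty, iUnion_empty] at hcov
    exact empty_ne_univ hcov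
  obtain ⟨e, he⟩ := hs.exists_eq_range hsne
  exact ⟨fun n => V (e n), fun n => hV _, fun n => hVK _, by rw [← hcov, he, biUnion_range]⟩

theorem FullContinuousSystem.sigmaFinite_comp (α : FullContinuousSystem π)
    (hY : LocallyCompactLocallyHausdorff Y) (μ : Measure X) [IsFiniteMeasure μ] :
    SigmaFinite (α.comp μ) := by
  obtain ⟨V, hV, -, hcov⟩ := α.exists_cover_isUniformlyFinite hY
  exact ⟨⟨⟨V, fun _ => trivial, fun n => (hV n).comp_lt_top hY μ, hcov⟩⟩⟩

/-- The measure `μ ∘ α` is inner regular on uniformly finite open sets. -/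
theorem FullContinuousSystem.IsUniformlyFinite.exists_lt_isCompact {α : FullContinuousSystem π}
    (hY : LocallyCompactLocallyHausdorff Y) {W : Set Y} (hW : α.IsUniformlyFinite W)
    (μ : Measure X) [IsFiniteMeasure μ] [μ.Regular] {r : ℝ≥0∞} (hr : r < α.comp μ W) :
    ∃ C ⊆ W, IsCompact C ∧ r < α.comp μ C := by
  have := hW.t2Space
  obtain ⟨M, hM⟩ := hW.bound
  rw [α.comp_apply hY _ hW.isOpen.measurableSet] at hr
  -- The integrand becomes a directed, bounded, possibly uncountable supremum of lower
  -- semicontinuous functions of `x`; `τ`-additivity then yields one relatively compact `V` with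
  -- large measure.
  simp only [α.onTotal_eq_iSup hY hW.isOpen] at hr
  have : Nonempty {V : Set Y // IsOpen V ∧ ∃ C, IsCompact C ∧ V ⊆ C ∧ C ⊆ W} :=
    ⟨∅, isOpen_empty, ∅, isCompact_empty, Subset.rfl, empty_subset _⟩
  rw [lintegral_iSup_directed_lowerSemicontinuous μ (M := M) ?_ ?_ ?_] at hr
  · obtain ⟨⟨V, hV, C, hC, hVC, hCW⟩, hr⟩ := lt_iSup_iff.1 hr
    refine ⟨C, hCW, hC, hr.trans_le ?_⟩
    rw [← α.comp_apply hY _ hV.measurableSet]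
    exact measure_mono hVC
  · rintro ⟨V, hV, C, hC, hVC, hCW⟩
    have : T2Space V := t2Space_of_subset (hVC.trans hCW)
    exact α.lowerSemicontinuous_open hY hV
  · rintro ⟨V, hV, C, hC, hVC, hCW⟩ ⟨V', hV', C', hC', hVC', hCW'⟩
    exact ⟨⟨V ∪ V', hV.union hV', C ∪ C', hC.union hC', union_subset_union hVC hVC',
      union_subset hCW hCW'⟩, fun x => measure_mono subset_union_left,
      fun x => measure_mono subset_union_right⟩
  · rintro ⟨V, hV, C, hC, hVC, hCW⟩ x
    exact (measure_mono (hVC.trans hCW)).trans (hM x)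

theorem FullContinuousSystem.IsUniformlyFinite.isFiniteMeasure_comap {α : FullContinuousSystem π}
    (hY : LocallyCompactLocallyHausdorff Y) {U : Set Y} (hU : α.IsUniformlyFinite U)
    (μ : Measure X) [IsFiniteMeasure μ] :
    IsFiniteMeasure ((α.comp μ).comap (Subtype.val : U → Y)) := by
  refine ⟨?_⟩
  rw [comap_subtype_coe_apply hU.isOpen.measurableSet]
  exact (measure_mono (by simp)).trans_lt (hU.comp_lt_top hY μ)

/-- Open subsets of `U` are again uniformly finite, so they are approximated by compact sets from
inside. This makes the results on `C_c` of a locally compact Hausdorff space applicable on `U`. -/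
theorem FullContinuousSystem.IsUniformlyFinite.regular_comap {α : FullContinuousSystem π}
    (hY : LocallyCompactLocallyHausdorff Y) {U : Set Y} (hU : α.IsUniformlyFinite U)
    (μ : Measure X) [IsFiniteMeasure μ] [μ.Regular] :
    ((α.comp μ).comap (Subtype.val : U → Y)).Regular := by
  have := hU.isFiniteMeasure_comap hY μ
  have := hU.t2Space
  refine Measure.Regular.of_innerRegularWRT_isCompact_isOpen fun W hW r hr => ?_
  rw [comap_subtype_coe_apply hU.isOpen.measurableSet] at hr
  obtain ⟨C, hCW, hC, hrC⟩ := (hU.mono (hU.isOpen.isOpenMap_subtype_val W hW)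
    (by rintro _ ⟨u, -, rfl⟩; exact u.2)).exists_lt_isCompact hY μ hr
  have hCU : C ⊆ range (Subtype.val : U → Y) := hCW.trans (image_subset_range _ _)
  refine ⟨Subtype.val ⁻¹' C, fun u hu => ?_, ?_, ?_⟩
  · obtain ⟨v, hv, hvu⟩ := hCW hu
    rwa [← Subtype.ext hvu]
  · rwa [Topology.IsInducing.subtypeVal.isCompact_preimage_iff hCU]
  · rwa [comap_subtype_coe_apply hU.isOpen.measurableSet, image_preimage_eq_of_subset hCU]

end Comp

/-! ### Uniqueness of densities and the Radon property. -/

section Density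

variable {X Y : Type*} [TopologicalSpace X] [T2Space X] [TopologicalSpace Y] [MeasurableSpace Y]
  [BorelSpace Y] {π : C(Y, X)}

/-- Extension by zero, as a linear map from `C_c(U)` to `𝒞_c(Y)`. -/
noncomputable def FullContinuousSystem.extendByZero (α : FullContinuousSystem π) {U : Set Y}
    (hU : IsOpen U) [T2Space U] : C_c(U, ℂ) →ₗ[ℂ] CcL1 α where
  toFun f := ⟨Function.extend Subtype.val f 0,
    Submodule.subset_span (isExtensionByZero_extend hU f)⟩
  map_add' f g := Subtype.ext <| by
    change _ = Function.extend Subtype.val f 0 + Function.extend Subtype.val g 0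
    rw [← Function.extend_add]
    simp
  map_smul' c f := Subtype.ext <| by
    change _ = c • Function.extend Subtype.val f 0
    rw [← Function.extend_smul]
    simp

theorem FullContinuousSystem.extendByZero_apply (α : FullContinuousSystem π) {U : Set Y}
    (hU : IsOpen U) [T2Space U] (f : C_c(U, ℂ)) (y : U) : α.extendByZero hU f y = f y :=
  Subtype.val_injective.extend_apply _ _ _

theorem FullContinuousSystem.extendByZero_apply_of_notMem (α : FullContinuousSystem π) {U : Set Y}
    (hU : IsOpen U) [T2Space U] (f : C_c(U, ℂ)) {y : Y} (hy : y ∉ U) :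
    α.extendByZero hU f y = 0 :=
  Function.extend_apply' _ _ _ (by rintro ⟨a, rfl⟩; exact hy a.2)

variable [MeasurableSpace X] [BorelSpace X] [SigmaCompactSpace Y]

/-- A bounded function which is orthogonal to `C_c(U)` vanishes almost everywhere on `U`. -/
theorem FullContinuousSystem.IsUniformlyFinite.ae_restrict_eq_zero {α : FullContinuousSystem π}
    (hY : LocallyCompactLocallyHausdorff Y) {U : Set Y} (hU : α.IsUniformlyFinite U)
    (μ : Measure X) [IsFiniteMeasure μ] [μ.Regular] {g : Y → ℂ} (hg : Measurable g) {c : ℝ}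
    (hgc : ∀ᵐ y ∂(α.comp μ), ‖g y‖ ≤ c)
    (h : ∀ (f : CcL1 α) (K : Set Y), ContinuousOn f U → IsCompact K → K ⊆ U →
      (∀ y, y ∉ K → f y = 0) → ∫ y, f y * g y ∂(α.comp μ) = 0) :
    ∀ᵐ y ∂((α.comp μ).restrict U), g y = 0 := by
  have := hU.t2Space
  have := hU.isFiniteMeasure_comap hY μ
  have := hU.regular_comap hY μ
  have := hY.locallyCompactSpace hU.isOpen
  have hUm := hU.isOpen.measurableSet
  rw [ae_restrict_iff_subtype hUm]
  refine CompactlySupportedContinuousMap.ae_eq_zero_of_integral_mul_eq_zero _ (g := fun y : U => g y)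
    (MemLp.of_bound (hg.comp measurable_subtype_coe).aestronglyMeasurable c
      ((ae_restrict_iff_subtype hUm).1 (ae_restrict_of_ae hgc))) fun f => ?_
  obtain ⟨hc, K, hK, hKU, h0⟩ := continuousOn_extend_and_exists_isCompact f
  rw [← h (α.extendByZero hU.isOpen f) K hc hK hKU h0,
    ← setIntegral_eq_integral_of_forall_compl_eq_zero (s := U) fun y hy => by
      rw [α.extendByZero_apply_of_notMem _ _ hy, zero_mul],
    ← integral_subtype_comap hUm]
  simp only [α.extendByZero_apply]

theorem ae_of_forall_ae_restrict {ν : Measure Y} {V : ℕ → Set Y}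
    (hV : ⋃ n, V n = univ) {p : Y → Prop} (h : ∀ n, ∀ᵐ y ∂(ν.restrict (V n)), p y) :
    ∀ᵐ y ∂ν, p y := by
  rw [← Measure.restrict_univ (μ := ν), ← hV]
  exact (ae_restrict_iUnion_iff V p).2 h

theorem IsBoundedBorel.comp_lt_top {B : Set Y} (hB : IsBoundedBorel B)
    (α : FullContinuousSystem π) (hY : LocallyCompactLocallyHausdorff Y) (μ : Measure X)
    [IsFiniteMeasure μ] : α.comp μ B < ∞ := by
  obtain ⟨-, K, hK, hBK⟩ := hB
  refine (measure_mono hBK).trans_lt (hK.measure_lt_top_of_nhdsWithin fun y _ => ?_)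
  obtain ⟨W, hW, hyW, -⟩ := α.exists_isUniformlyFinite hY y
  exact ⟨W, mem_nhdsWithin_of_mem_nhds (hW.isOpen.mem_nhds hyW), hW.comp_lt_top hY μ⟩

/-- Two complex measures with bounded densities with respect to measures `μ ∘ α` and `μ' ∘ α` define
the same form on `𝒞_c(Y)` if and only if they agree on the Borel subsets of compact sets. -/
theorem FullContinuousSystem.forall_integral_eq_iff (α : FullContinuousSystem π)
    (hY : LocallyCompactLocallyHausdorff Y) (μ μ' : Measure X) [IsFiniteMeasure μ] [μ.Regular]
    [IsFiniteMeasure μ'] [μ'.Regular] {φ φ' : Y → ℂ} (hφ : Measurable φ) (hφ' : Measurable φ')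
    {c c' : ℝ} (hc : ∀ y, ‖φ y‖ ≤ c) (hc' : ∀ y, ‖φ' y‖ ≤ c') :
    (∀ f : CcL1 α, ∫ y, f y * φ y ∂(α.comp μ) = ∫ y, f y * φ' y ∂(α.comp μ')) ↔
      ∀ B, IsBoundedBorel B → ∫ y in B, φ y ∂(α.comp μ) = ∫ y in B, φ' y ∂(α.comp μ') := by
  have hreg : (μ + μ').Regular := Measure.Regular.add_of_isFiniteMeasure μ μ'
  have := α.sigmaFinite_comp hY μ
  have := α.sigmaFinite_comp hY μ'
  have := α.sigmaFinite_comp hY (μ + μ')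
  set ρ := α.comp (μ + μ') with hρ
  have hle : α.comp μ ≤ ρ := by rw [hρ, α.comp_add hY]; exact Measure.le_add_right le_rfl
  have hle' : α.comp μ' ≤ ρ := by rw [hρ, α.comp_add hY]; exact Measure.le_add_left le_rfl
  have hac := Measure.absolutelyContinuous_of_le hle
  have hac' := Measure.absolutelyContinuous_of_le hle'
  set r := (α.comp μ).rnDeriv ρ with hr
  set r' := (α.comp μ').rnDeriv ρ with hr'
  -- `G` is the density of the difference of the two complex measures with respect to `ρ`. It is
  -- bounded because `r` and `r'` are at most `1` almost everywhere.
  set G : Y → ℂ := fun y => (r y).toReal • φ y - (r' y).toReal • φ' y with hG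
  have hGm : Measurable G :=
    ((Measure.measurable_rnDeriv _ _).ennreal_toReal.smul hφ).sub
      ((Measure.measurable_rnDeriv _ _).ennreal_toReal.smul hφ')
  have hGb : ∀ᵐ y ∂ρ, ‖G y‖ ≤ c + c' := by
    filter_upwards [Measure.rnDeriv_le_one_of_le hle, Measure.rnDeriv_le_one_of_le hle'] with y h h'
    have h1 : (r y).toReal ≤ 1 := ENNReal.toReal_le_of_le_ofReal zero_le_one (by simpa using h)
    have h1' : (r' y).toReal ≤ 1 := ENNReal.toReal_le_of_le_ofReal zero_le_one (by simpa using h')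
    refine (norm_sub_le _ _).trans (add_le_add ?_ ?_)
    · rw [norm_smul, Real.norm_of_nonneg ENNReal.toReal_nonneg]
      exact (mul_le_of_le_one_left (norm_nonneg _) h1).trans (hc y)
    · rw [norm_smul, Real.norm_of_nonneg ENNReal.toReal_nonneg]
      exact (mul_le_of_le_one_left (norm_nonneg _) h1').trans (hc' y)
  have hsub : ∀ f : Y → ℂ, Integrable f (α.comp μ) → Integrable f (α.comp μ') →
      ∫ y, f y * φ y ∂(α.comp μ) - ∫ y, f y * φ' y ∂(α.comp μ') = ∫ y, f y * G y ∂ρ := by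
    intro f hf hf'
    have h1 := hf.mul_bdd hφ.aestronglyMeasurable (Eventually.of_forall hc)
    have h1' := hf'.mul_bdd hφ'.aestronglyMeasurable (Eventually.of_forall hc')
    rw [← integral_rnDeriv_smul hac, ← integral_rnDeriv_smul hac', ← integral_sub
      ((integrable_rnDeriv_smul_iff hac).2 h1) ((integrable_rnDeriv_smul_iff hac').2 h1')]
    refine integral_congr_ae (Eventually.of_forall fun y => ?_)
    simp only [hG, mul_sub, mul_smul_comm, hr, hr']
  have hsubS : ∀ B, MeasurableSet B → α.comp μ B < ∞ → α.comp μ' B < ∞ →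
      ∫ y in B, φ y ∂(α.comp μ) - ∫ y in B, φ' y ∂(α.comp μ') = ∫ y in B, G y ∂ρ := by
    intro B hB hfin hfin'
    have h := hsub (B.indicator 1) ((integrable_indicator_iff hB).2 (integrableOn_const hfin.ne))
      ((integrable_indicator_iff hB).2 (integrableOn_const hfin'.ne))
    have he : ∀ k : Y → ℂ, (fun y => B.indicator 1 y * k y) = B.indicator k := fun k => by
      ext y
      by_cases hy : y ∈ B <;> simp [hy]
    simpa only [he, integral_indicator hB] using h
  obtain ⟨V, hV, hVK, hcov⟩ := α.exists_cover_isUniformlyFinite hY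
  -- Each of the two conditions follows from `G = 0` almost everywhere, so it is enough that each of
  -- them implies it.
  suffices hzero : ((∀ f : CcL1 α, ∫ y, f y * φ y ∂(α.comp μ) = ∫ y, f y * φ' y ∂(α.comp μ')) →
      ∀ᵐ y ∂ρ, G y = 0) ∧ ((∀ B, IsBoundedBorel B →
      ∫ y in B, φ y ∂(α.comp μ) = ∫ y in B, φ' y ∂(α.comp μ')) → ∀ᵐ y ∂ρ, G y = 0) by
    refine ⟨fun h B hB => sub_eq_zero.1 ?_, fun h f => sub_eq_zero.1 ?_⟩
    · rw [hsubS B hB.1 (hB.comp_lt_top α hY μ) (hB.comp_lt_top α hY μ')]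
      exact integral_eq_zero_of_ae (ae_restrict_of_ae (hzero.1 h))
    · rw [hsub f (α.integrable_comp hY μ f) (α.integrable_comp hY μ' f)]
      exact integral_eq_zero_of_ae ((hzero.2 h).mono fun y hy => by simp [hy])
  refine ⟨fun h => ae_of_forall_ae_restrict hcov fun n => ?_,
    fun h => ae_of_forall_ae_restrict hcov fun n => ?_⟩
  · refine (hV n).ae_restrict_eq_zero hY (μ + μ') hGm hGb fun f _ _ _ _ _ => ?_
    rw [← hρ, ← hsub f (α.integrable_comp hY μ f) (α.integrable_comp hY μ' f), h f, sub_self]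
  · have hVm := (hV n).isOpen.measurableSet
    have : IsFiniteMeasure (ρ.restrict (V n)) :=
      ⟨by rw [Measure.restrict_apply_univ]; exact (hV n).comp_lt_top hY _⟩
    have hint : Integrable G (ρ.restrict (V n)) :=
      memLp_one_iff_integrable.1 (MemLp.of_bound hGm.aestronglyMeasurable _ (ae_restrict_of_ae hGb))
    refine hint.ae_eq_zero_of_forall_setIntegral_eq_zero fun B hB _ => ?_
    obtain ⟨K, hK, hVK⟩ := hVK n
    have hBb : IsBoundedBorel (B ∩ V n) :=
      ⟨hB.inter hVm, K, hK, inter_subset_right.trans hVK⟩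
    rw [Measure.restrict_restrict hB, ← hsubS _ hBb.1 (hBb.comp_lt_top α hY μ) (hBb.comp_lt_top α hY μ'), h _ hBb,
      sub_self]

/-- The measure `μ ∘ α` is inner regular on the Borel subsets of compact sets. -/
theorem FullContinuousSystem.exists_isCompact_comp_diff_lt (α : FullContinuousSystem π)
    (hY : LocallyCompactLocallyHausdorff Y) (μ : Measure X) [IsFiniteMeasure μ] [μ.Regular]
    {B : Set Y} (hB : IsBoundedBorel B) {ε : ℝ≥0∞} (hε : ε ≠ 0) :
    ∃ C ⊆ B, IsCompact C ∧ MeasurableSet C ∧ α.comp μ (B \ C) < ε := by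
  obtain ⟨V, hV, -, hcov⟩ := α.exists_cover_isUniformlyFinite hY
  have hloc : ∀ n B, MeasurableSet B → B ⊆ V n → ∀ ε : ℝ≥0∞, ε ≠ 0 →
      ∃ C ⊆ B, IsCompact C ∧ MeasurableSet C ∧ α.comp μ (B \ C) < ε := by
    intro n B hB hBV ε hε
    have := (hV n).t2Space
    have := (hV n).isFiniteMeasure_comap hY μ
    have := (hV n).regular_comap hY μ
    have hVm := (hV n).isOpen.measurableSet
    obtain ⟨C, hCB, hC, hCε⟩ :=
      (measurable_subtype_coe hB : MeasurableSet ((Subtype.val : V n → Y) ⁻¹' B)).exists_isCompact_sdiff_lt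
        (measure_ne_top ((α.comp μ).comap (Subtype.val : V n → Y)) _) hε
    -- Compact subsets of `Y` need not be Borel; this one is, being closed in the Hausdorff open set
    -- `V n`.
    refine ⟨Subtype.val '' C, image_subset_iff.2 hCB, hC.image continuous_subtype_val,
      (MeasurableEmbedding.subtype_coe hVm).measurableSet_image.2 hC.measurableSet, ?_⟩
    rw [comap_subtype_coe_apply hVm, image_sdiff Subtype.val_injective,
      image_preimage_eq_of_subset (by simpa using hBV)] at hCε
    exact hCε
  -- Finite unions of the `V n` may fail to be Hausdorff, so `B` is split into `B ∩ V N` and `B \ V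
  -- N`, with error `ε / 2` for each.
  have hfin : ∀ N B, MeasurableSet B → B ⊆ (⋃ n < N, V n) → ∀ ε : ℝ≥0∞, ε ≠ 0 →
      ∃ C ⊆ B, IsCompact C ∧ MeasurableSet C ∧ α.comp μ (B \ C) < ε := by
    intro N
    induction N with
    | zero =>
      intro B _ hBV ε hε
      have : B = ∅ := subset_empty_iff.1 (by simpa using hBV)
      exact ⟨∅, empty_subset _, isCompact_empty, MeasurableSet.empty, by
        simpa [this] using pos_iff_ne_zero.2 hε⟩
    | succ N ih =>
      intro B hB hBV ε hε
      have hε2 : ε / 2 ≠ 0 := by simpa using hε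
      have hVm := (hV N).isOpen.measurableSet
      obtain ⟨C, hCB, hC, hCm, hCε⟩ := hloc N _ (hB.inter hVm) inter_subset_right _ hε2
      obtain ⟨D, hDB, hD, hDm, hDε⟩ := ih _ (hB.diff hVm) (fun y hy => by
        obtain ⟨n, hn, hyn⟩ := mem_iUnion₂.1 (hBV hy.1)
        refine mem_iUnion₂.2 ⟨n, lt_of_le_of_ne (Nat.lt_succ_iff.1 hn) ?_, hyn⟩
        rintro rfl
        exact hy.2 hyn) _ hε2
      refine ⟨C ∪ D, union_subset (hCB.trans inter_subset_left) (hDB.trans sdiff_subset),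
        hC.union hD, hCm.union hDm, ?_⟩
      calc α.comp μ (B \ (C ∪ D)) ≤ α.comp μ (((B ∩ V N) \ C) ∪ ((B \ V N) \ D)) := by
            refine measure_mono fun y hy => ?_
            by_cases hyV : y ∈ V N
            · exact Or.inl ⟨⟨hy.1, hyV⟩, fun h => hy.2 (Or.inl h)⟩
            · exact Or.inr ⟨⟨hy.1, hyV⟩, fun h => hy.2 (Or.inr h)⟩
        _ ≤ _ := measure_union_le _ _
        _ < ε / 2 + ε / 2 := ENNReal.add_lt_add hCε hDε
        _ = ε := ENNReal.add_halves _
  obtain ⟨hBm, K, hK, hBK⟩ := hB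
  obtain ⟨N, hN⟩ := hK.elim_directed_cover (fun N => ⋃ n < N, V n)
    (fun N => isOpen_biUnion fun n _ => (hV n).isOpen) (fun y _ => by
      obtain ⟨n, hn⟩ := mem_iUnion.1 (hcov ▸ mem_univ y)
      exact mem_iUnion.2 ⟨n + 1, mem_iUnion₂.2 ⟨n, n.lt_succ_self, hn⟩⟩)
    (Monotone.directed_le fun a b hab => biUnion_subset_biUnion_left fun n hn =>
      lt_of_lt_of_le hn hab)
  exact hfin N B hBm (hBK.trans hN) ε hε

theorem FullContinuousSystem.isComplexBorelRadon (α : FullContinuousSystem π)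
    (hY : LocallyCompactLocallyHausdorff Y) (μ : Measure X) [IsFiniteMeasure μ] [μ.Regular]
    {φ : Y → ℂ} (hφ : Measurable φ) (hφ1 : ∀ y, ‖φ y‖ ≤ 1) :
    IsComplexBorelRadon fun B => ∫ y in B, φ y ∂(α.comp μ) := by
  refine ⟨fun B hB hd hU => hasSum_integral_iUnion hB hd ?_, fun B hB ε hε => ?_⟩
  · exact Measure.integrableOn_of_bounded (hU.comp_lt_top α hY μ).ne hφ.aestronglyMeasurable
      (Eventually.of_forall hφ1)
  · obtain ⟨C, hCB, hC, hCm, hCε⟩ := α.exists_isCompact_comp_diff_lt hY μ hB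
      (ENNReal.ofReal_pos.2 hε).ne'
    refine ⟨C, hCB, hC, hCm, fun A _ hAB => ?_⟩
    have hA : α.comp μ A < ENNReal.ofReal ε := (measure_mono hAB).trans_lt hCε
    refine (norm_setIntegral_le_of_norm_le_const (hA.trans ENNReal.ofReal_lt_top)
      fun y _ => hφ1 y).trans_lt ?_
    rw [one_mul]
    exact (ENNReal.toReal_lt_of_lt_ofReal hA)

end Density

/-! ### The functional `Λ` and the dominating measure. -/

section Domination

variable {X Y : Type*} [TopologicalSpace X] [T2Space X] [TopologicalSpace Y] [MeasurableSpace Y]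
  [BorelSpace Y] {π : C(Y, X)}

/-- The supremum of `|Ψ(f)|` over the functions `f` with `∫ |f| dα^x ≤ h(x)` for all `x`. -/
noncomputable def FullContinuousSystem.dominatedSup (α : FullContinuousSystem π)
    (Ψ : CcL1 α →ₗ[ℂ] ℂ) (h : X → ℝ) : ℝ :=
  sSup {r | ∃ f : CcL1 α, (∀ x, ∫ y, ‖f y‖ ∂(α.fibreMeasure x) ≤ h x) ∧ r = ‖Ψ f‖}

variable {α : FullContinuousSystem π} {Ψ : CcL1 α →ₗ[ℂ] ℂ} {C : ℝ}

theorem FullContinuousSystem.integral_norm_smul (c : ℂ) (f : CcL1 α) (x : X) :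
    ∫ y, ‖(c • f) y‖ ∂(α.fibreMeasure x) = ‖c‖ * ∫ y, ‖f y‖ ∂(α.fibreMeasure x) := by
  rw [← integral_const_mul]
  exact integral_congr_ae (Eventually.of_forall fun y => norm_smul c (f y))

theorem FullContinuousSystem.integral_norm_add_le (f g : CcL1 α) (x : X) :
    ∫ y, ‖(f + g) y‖ ∂(α.fibreMeasure x) ≤
      ∫ y, ‖f y‖ ∂(α.fibreMeasure x) + ∫ y, ‖g y‖ ∂(α.fibreMeasure x) := by
  rw [← integral_add (α.integrable f.2 x).norm (α.integrable g.2 x).norm]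
  exact integral_mono ((α.integrable f.2 x).add (α.integrable g.2 x)).norm
    ((α.integrable f.2 x).norm.add (α.integrable g.2 x).norm) fun y => norm_add_le _ _

/-- The product of a function in `𝒞_c(Y)` with a continuous function on the base. -/
def FullContinuousSystem.baseMul (k : C(X, ℝ)) (f : CcL1 α) : CcL1 α :=
  ⟨fun y => (k (π y) : ℂ) * f y, Cc.mul_continuous f.2 (k := fun y => (k (π y) : ℂ)) (by fun_prop)⟩

theorem FullContinuousSystem.integral_norm_baseMul (k : C(X, ℝ)) (f : CcL1 α) (x : X) :
    ∫ y, ‖baseMul k f y‖ ∂(α.fibreMeasure x) = |k x| * ∫ y, ‖f y‖ ∂(α.fibreMeasure x) := by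
  rw [← integral_const_mul]
  refine integral_congr_ae (Eventually.of_forall fun y => ?_)
  have : π y = x := y.2
  simp only [baseMul, norm_mul, Complex.norm_real, Real.norm_eq_abs, this]

section

variable (hΨ : ∀ f, ‖Ψ f‖ ≤ C * ‖f‖)
include hΨ

theorem FullContinuousSystem.norm_le_of_integral_norm_le (hC : 0 ≤ C) {M : ℝ} (hM : 0 ≤ M)
    {f : CcL1 α} (hf : ∀ x, ∫ y, ‖f y‖ ∂(α.fibreMeasure x) ≤ M) : ‖Ψ f‖ ≤ C * M :=
  (hΨ f).trans (mul_le_mul_of_nonneg_left (α.norm_le f hM hf) hC)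

theorem FullContinuousSystem.le_dominatedSup (hC : 0 ≤ C) {h : X → ℝ} (hb : ∃ M, ∀ x, h x ≤ M)
    {f : CcL1 α} (hf : ∀ x, ∫ y, ‖f y‖ ∂(α.fibreMeasure x) ≤ h x) :
    ‖Ψ f‖ ≤ α.dominatedSup Ψ h := by
  obtain ⟨M, hM⟩ := hb
  -- Boundedness is needed here: the real `sSup` of an unbounded set is `0`.
  refine le_csSup ⟨C * max M 0, ?_⟩ ⟨f, hf, rfl⟩
  rintro _ ⟨g, hg, rfl⟩
  exact norm_le_of_integral_norm_le hΨ hC (le_max_right _ _)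
    fun x => (hg x).trans ((hM x).trans (le_max_left _ _))

omit hΨ in
theorem FullContinuousSystem.dominatedSup_le {h : X → ℝ} (h0 : ∀ x, 0 ≤ h x) {r : ℝ}
    (hr : ∀ f : CcL1 α, (∀ x, ∫ y, ‖f y‖ ∂(α.fibreMeasure x) ≤ h x) → ‖Ψ f‖ ≤ r) :
    α.dominatedSup Ψ h ≤ r := by
  refine csSup_le ⟨_, 0, fun x => ?_, rfl⟩ ?_
  · have := integral_norm_smul (0 : ℂ) (0 : CcL1 α) x
    rw [norm_zero, zero_mul, smul_zero] at this
    exact this.le.trans (h0 x)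
  · rintro _ ⟨f, hf, rfl⟩
    exact hr f hf

omit hΨ in
theorem FullContinuousSystem.dominatedSup_nonneg (h : X → ℝ) : 0 ≤ α.dominatedSup Ψ h :=
  Real.sSup_nonneg (by rintro _ ⟨f, -, rfl⟩; exact norm_nonneg _)

/-- For `≤`, `f` is cut into pieces by the functions `h₁ / (h₁ + h₂ + δ)`, `h₂ / (h₁ + h₂ + δ)` and
`δ / (h₁ + h₂ + δ)` of the base point. The term `δ` avoids division by zero, and its piece
contributes at most `C δ`. For `≥`, phases are chosen so that the values of `Ψ` add up in modulus.
-/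
theorem FullContinuousSystem.dominatedSup_add (hC : 0 ≤ C) {h₁ h₂ : C(X, ℝ)} (h₁0 : ∀ x, 0 ≤ h₁ x)
    (h₂0 : ∀ x, 0 ≤ h₂ x) (h₁b : ∃ M, ∀ x, h₁ x ≤ M) (h₂b : ∃ M, ∀ x, h₂ x ≤ M) :
    α.dominatedSup Ψ (h₁ + h₂) = α.dominatedSup Ψ h₁ + α.dominatedSup Ψ h₂ := by
  have hb : ∃ M, ∀ x, (h₁ + h₂ : X → ℝ) x ≤ M := by
    obtain ⟨M, hM⟩ := h₁b
    obtain ⟨N, hN⟩ := h₂b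
    exact ⟨M + N, fun x => add_le_add (hM x) (hN x)⟩
  refine le_antisymm (dominatedSup_le (fun x => add_nonneg (h₁0 x) (h₂0 x)) fun f hf => ?_) ?_
  · refine le_of_forall_pos_le_add fun ε hε => ?_
    obtain ⟨δ, hδ, hδε⟩ : ∃ δ, 0 < δ ∧ C * δ ≤ ε := by
      refine ⟨ε / (C + 1), by positivity, ?_⟩
      rw [mul_div_assoc', div_le_iff₀ (by positivity)]
      nlinarith
    have hpos : ∀ x, 0 < h₁ x + h₂ x + δ := fun x => by linarith [h₁0 x, h₂0 x]
    let k₁ : C(X, ℝ) := ⟨fun x => h₁ x / (h₁ x + h₂ x + δ),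
      h₁.continuous.div (by fun_prop) fun x => (hpos x).ne'⟩
    let k₂ : C(X, ℝ) := ⟨fun x => h₂ x / (h₁ x + h₂ x + δ),
      h₂.continuous.div (by fun_prop) fun x => (hpos x).ne'⟩
    let k₃ : C(X, ℝ) := ⟨fun x => δ / (h₁ x + h₂ x + δ),
      continuous_const.div (by fun_prop) fun x => (hpos x).ne'⟩
    have hk : ∀ (k : C(X, ℝ)) (a : X → ℝ), (∀ x, 0 ≤ a x) →
        (∀ x, k x = a x / (h₁ x + h₂ x + δ)) → ∀ x,
        ∫ y, ‖baseMul k f y‖ ∂(α.fibreMeasure x) ≤ a x := fun k a ha hka x => by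
      rw [integral_norm_baseMul, hka, abs_of_nonneg (div_nonneg (ha x) (hpos x).le),
        div_mul_eq_mul_div, div_le_iff₀ (hpos x)]
      refine mul_le_mul_of_nonneg_left ((hf x).trans ?_) (ha x)
      change h₁ x + h₂ x ≤ _
      linarith
    have hsum : f = baseMul k₁ f + baseMul k₂ f + baseMul k₃ f := by
      refine Subtype.ext (funext fun y => ?_)
      change f y = (k₁ (π y) : ℂ) * f y + (k₂ (π y) : ℂ) * f y + (k₃ (π y) : ℂ) * f y
      have : k₁ (π y) + k₂ (π y) + k₃ (π y) = 1 := by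
        change h₁ (π y) / _ + h₂ (π y) / _ + δ / _ = 1
        rw [← add_div, ← add_div, div_self (hpos _).ne']
      rw [← add_mul, ← add_mul, ← Complex.ofReal_add, ← Complex.ofReal_add, this, Complex.ofReal_one,
        one_mul]
    calc ‖Ψ f‖ = ‖Ψ (baseMul k₁ f) + Ψ (baseMul k₂ f) + Ψ (baseMul k₃ f)‖ := by
          conv_lhs => rw [hsum, map_add, map_add]
      _ ≤ ‖Ψ (baseMul k₁ f)‖ + ‖Ψ (baseMul k₂ f)‖ + ‖Ψ (baseMul k₃ f)‖ := norm_add₃_le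
      _ ≤ α.dominatedSup Ψ h₁ + α.dominatedSup Ψ h₂ + ε := by
          refine add_le_add (add_le_add ?_ ?_) ?_
          · exact le_dominatedSup hΨ hC h₁b (hk k₁ h₁ h₁0 fun _ => rfl)
          · exact le_dominatedSup hΨ hC h₂b (hk k₂ h₂ h₂0 fun _ => rfl)
          · exact (norm_le_of_integral_norm_le hΨ hC hδ.le
              (hk k₃ (fun _ => δ) (fun _ => hδ.le) fun _ => rfl)).trans hδε
  · rw [← le_sub_iff_add_le]
    refine dominatedSup_le h₁0 fun f₁ hf₁ => ?_
    rw [le_sub_comm]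
    refine dominatedSup_le h₂0 fun f₂ hf₂ => ?_
    rw [le_sub_iff_add_le']
    obtain ⟨c₁, hc₁, he₁⟩ := RCLike.exists_norm_eq_mul_self (Ψ f₁)
    obtain ⟨c₂, hc₂, he₂⟩ := RCLike.exists_norm_eq_mul_self (Ψ f₂)
    have hΨe : ‖Ψ (c₁ • f₁ + c₂ • f₂)‖ = ‖Ψ f₁‖ + ‖Ψ f₂‖ := by
      rw [map_add, map_smul, map_smul, smul_eq_mul, smul_eq_mul, ← he₁, ← he₂]
      rw [← RCLike.ofReal_add, RCLike.norm_ofReal, abs_of_nonneg (by positivity)]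
    rw [← hΨe]
    refine le_dominatedSup hΨ hC hb fun x => (integral_norm_add_le _ _ x).trans ?_
    rw [integral_norm_smul, integral_norm_smul, hc₁, hc₂, one_mul, one_mul]
    exact add_le_add (hf₁ x) (hf₂ x)

theorem FullContinuousSystem.mul_dominatedSup_le (hC : 0 ≤ C) {h : X → ℝ} (h0 : ∀ x, 0 ≤ h x)
    (hb : ∃ M, ∀ x, h x ≤ M) {c : ℝ} (hc : 0 < c) :
    c * α.dominatedSup Ψ h ≤ α.dominatedSup Ψ (fun x => c * h x) := by
  rw [← le_div_iff₀' hc]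
  refine dominatedSup_le h0 fun f hf => ?_
  rw [le_div_iff₀' hc]
  have : c * ‖Ψ f‖ = ‖Ψ ((c : ℂ) • f)‖ := by
    rw [map_smul, norm_smul, Complex.norm_real, Real.norm_of_nonneg hc.le]
  rw [this]
  obtain ⟨M, hM⟩ := hb
  refine le_dominatedSup hΨ hC ⟨c * M, fun x => mul_le_mul_of_nonneg_left (hM x) hc.le⟩ fun x => ?_
  rw [integral_norm_smul, Complex.norm_real, Real.norm_of_nonneg hc.le]
  exact mul_le_mul_of_nonneg_left (hf x) hc.le

theorem FullContinuousSystem.dominatedSup_smul (hC : 0 ≤ C) {h : X → ℝ} (h0 : ∀ x, 0 ≤ h x)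
    (hb : ∃ M, ∀ x, h x ≤ M) {c : ℝ} (hc : 0 ≤ c) :
    α.dominatedSup Ψ (fun x => c * h x) = c * α.dominatedSup Ψ h := by
  rcases hc.eq_or_lt with rfl | hc
  · refine le_antisymm (dominatedSup_le (by simp) fun f hf => ?_) (by
      rw [zero_mul]; exact dominatedSup_nonneg _)
    have := norm_le_of_integral_norm_le hΨ hC le_rfl fun x => (hf x).trans_eq (zero_mul _)
    simpa using this
  · refine le_antisymm ?_ (mul_dominatedSup_le hΨ hC h0 hb hc)
    obtain ⟨M, hM⟩ := hb
    -- The reverse inequality is the same one for the factor `c⁻¹` and the function `c h`.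
    have := mul_dominatedSup_le hΨ hC (h := fun x => c * h x)
      (fun x => mul_nonneg hc.le (h0 x)) ⟨c * M, fun x => mul_le_mul_of_nonneg_left (hM x) hc.le⟩
      (inv_pos.2 hc)
    simp only [inv_mul_cancel_left₀ hc.ne'] at this
    rwa [inv_mul_le_iff₀ hc] at this

variable [LocallyCompactSpace X] [MeasurableSpace X] [BorelSpace X] [SigmaCompactSpace Y]

/-- A bounded linear form on `𝒞_c(Y)` is dominated, on each `C_c(U)`, by the `L¹` norm of a measure
`μ ∘ α` whose mass is bounded by the norm of the form. -/
theorem FullContinuousSystem.exists_dominating_measure (hY : LocallyCompactLocallyHausdorff Y)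
    (hC : 0 ≤ C) : ∃ μ : Measure X, IsFiniteMeasure μ ∧ μ.Regular ∧ μ.real univ ≤ C ∧
      ∀ f : CcL1 α, IsExtensionByZero (f : Y → ℂ) → ‖Ψ f‖ ≤ ∫ y, ‖f y‖ ∂(α.comp μ) := by
  have hbd : ∀ h : C_c(X, ℝ≥0), ∃ M : ℝ, ∀ x, (h x : ℝ) ≤ M := fun h => by
    obtain ⟨M, hM⟩ := (h.hasCompactSupport.comp_left (g := ((↑) : ℝ≥0 → ℝ))
      rfl).exists_bound_of_continuous (by fun_prop)
    exact ⟨M, fun x => (le_abs_self _).trans (hM x)⟩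
  let Λ : C_c(X, ℝ≥0) →ₗ[ℝ≥0] ℝ≥0 :=
    { toFun := fun h => ⟨α.dominatedSup Ψ fun x => h x, dominatedSup_nonneg _⟩
      map_add' := fun h₁ h₂ => NNReal.eq (dominatedSup_add hΨ hC
        (h₁ := ⟨fun x => (h₁ x : ℝ), by fun_prop⟩) (h₂ := ⟨fun x => (h₂ x : ℝ), by fun_prop⟩)
        (fun x => (h₁ x).2) (fun x => (h₂ x).2) (hbd h₁) (hbd h₂))
      map_smul' := fun c h => NNReal.eq (dominatedSup_smul hΨ hC (fun x => (h x).2) (hbd h) c.2) }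
  have hΛ : ∀ h, (Λ h : ℝ) = α.dominatedSup Ψ fun x => h x := fun h => rfl
  set μ := NNRealRMK.rieszMeasure Λ with hμ
  -- By inner regularity it suffices to bound `μ K`, and `μ K ≤ Λ h ≤ C` for a Urysohn function `h`
  -- with `1_K ≤ h ≤ 1`.
  have hμu : μ univ ≤ ENNReal.ofReal C := by
    rw [isOpen_univ.measure_eq_iSup_isCompact]
    refine iSup₂_le fun K _ => iSup_le fun hK => ?_
    obtain ⟨g, hg1, -, hgc, hg01⟩ := exists_continuous_one_zero_of_isCompact hK isClosed_empty
      (disjoint_empty _)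
    let h : C_c(X, ℝ≥0) := ⟨⟨fun x => (g x).toNNReal, by fun_prop⟩,
      hgc.comp_left (g := Real.toNNReal) Real.toNNReal_zero⟩
    calc μ K = ∫⁻ x, K.indicator 1 x ∂μ := (lintegral_indicator_one hK.measurableSet).symm
      _ ≤ ∫⁻ x, h x ∂μ := lintegral_mono fun x => by
          by_cases hx : x ∈ K
          · have : h x = 1 := by
              change (g x).toNNReal = 1
              rw [hg1 hx]; simp
            simp [hx, this]
          · simp [hx]
      _ = Λ h := NNRealRMK.lintegral_rieszMeasure Λ h
      _ ≤ ENNReal.ofReal C := by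
          rw [← ENNReal.ofReal_coe_nnreal, hΛ]
          refine ENNReal.ofReal_le_ofReal (dominatedSup_le (fun x => (h x).2) fun f hf => ?_)
          refine (norm_le_of_integral_norm_le hΨ hC zero_le_one fun x => (hf x).trans ?_).trans_eq
            (mul_one C)
          change ((g x).toNNReal : ℝ) ≤ 1
          rw [Real.coe_toNNReal _ (hg01 x).1]
          exact (hg01 x).2
  have hfin : IsFiniteMeasure μ := ⟨hμu.trans_lt ENNReal.ofReal_lt_top⟩
  refine ⟨μ, hfin, inferInstance, ENNReal.toReal_le_of_le_ofReal hC hμu, fun f hf => ?_⟩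
  -- Here `f` has to come from a single `C_c(U)`: only then is `|f|` known to be in `𝒞_c(Y)`, and `x
  -- ↦ ∫ |f| dα^x` a legitimate argument of `Λ`.
  have hm : (fun y => ((‖f y‖ : ℝ) : ℂ)) ∈ Cc Y := Submodule.subset_span hf.norm
  have hre : ∀ x, (∫ y, ((‖f y‖ : ℝ) : ℂ) ∂(α.fibreMeasure x)).re =
      ∫ y, ‖f y‖ ∂(α.fibreMeasure x) := fun x => by
    rw [integral_complex_ofReal, Complex.ofReal_re]
  have hcont : Continuous fun x => ∫ y, ‖f y‖ ∂(α.fibreMeasure x) := by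
    simpa only [Function.comp_def, hre] using
      Complex.continuous_re.comp (α.continuous_integral _ hm)
  have hsupp : HasCompactSupport fun x => ∫ y, ‖f y‖ ∂(α.fibreMeasure x) := by
    simpa only [Function.comp_def, hre] using
      (α.hasCompactSupport_integral _ hm).comp_left (g := Complex.re) rfl
  let h : C_c(X, ℝ≥0) := ⟨⟨fun x => (∫ y, ‖f y‖ ∂(α.fibreMeasure x)).toNNReal, by fun_prop⟩,
    hsupp.comp_left (g := Real.toNNReal) Real.toNNReal_zero⟩
  have hh : ∀ x, (h x : ℝ) = ∫ y, ‖f y‖ ∂(α.fibreMeasure x) := fun x =>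
    Real.coe_toNNReal _ (integral_nonneg fun y => norm_nonneg _)
  rw [integral_norm_eq_lintegral_enorm (Cc.measurable f.2).aestronglyMeasurable,
    α.lintegral_enorm_comp hY μ f.2]
  have hint : ∫⁻ x, ENNReal.ofReal (∫ y, ‖f y‖ ∂(α.fibreMeasure x)) ∂μ = Λ h :=
    NNRealRMK.lintegral_rieszMeasure Λ h
  rw [hint, ENNReal.coe_toReal, hΛ]
  exact le_dominatedSup hΨ hC (hbd h) fun x => (hh x).ge

end

end Domination

/-! ### Gluing local densities and representing continuous forms. -/

section Representation

variable {X Y : Type*} [TopologicalSpace X] [T2Space X] [TopologicalSpace Y] [MeasurableSpace Y]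
  [BorelSpace Y] {π : C(Y, X)} [MeasurableSpace X] [BorelSpace X] [SigmaCompactSpace Y]
  {α : FullContinuousSystem π}

/-- On `U` the form is bounded by the `L¹` norm of a finite regular measure, so `L¹` duality
applies; the density is extended by zero. -/
theorem FullContinuousSystem.IsUniformlyFinite.exists_density
    (hY : LocallyCompactLocallyHausdorff Y) {U : Set Y} (hU : α.IsUniformlyFinite U)
    (μ : Measure X) [IsFiniteMeasure μ] [μ.Regular] (Ψ : CcL1 α →ₗ[ℂ] ℂ)
    (hΨ : ∀ f : CcL1 α, IsExtensionByZero (f : Y → ℂ) → ‖Ψ f‖ ≤ ∫ y, ‖f y‖ ∂(α.comp μ)) :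
    ∃ φ : Y → ℂ, Measurable φ ∧ (∀ y, ‖φ y‖ ≤ 1) ∧ ∀ (f : CcL1 α) (K : Set Y),
      ContinuousOn f U → IsCompact K → K ⊆ U → (∀ y, y ∉ K → f y = 0) →
      Ψ f = ∫ y, f y * φ y ∂(α.comp μ) := by
  have := hU.t2Space
  have := hU.isFiniteMeasure_comap hY μ
  have := hU.regular_comap hY μ
  have := hY.locallyCompactSpace hU.isOpen
  have hUm := hU.isOpen.measurableSet
  obtain ⟨g, hg, hg1, hgΨ⟩ := CompactlySupportedContinuousMap.exists_density_of_le_integral_norm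
    ((α.comp μ).comap (Subtype.val : U → Y)) (Ψ ∘ₗ α.extendByZero hU.isOpen) fun f => by
      refine (hΨ _ (isExtensionByZero_extend hU.isOpen f)).trans_eq ?_
      rw [← setIntegral_eq_integral_of_forall_compl_eq_zero (s := U) fun y hy => by
        rw [α.extendByZero_apply_of_notMem _ _ hy, norm_zero], ← integral_subtype_comap hUm]
      simp only [α.extendByZero_apply]
  refine ⟨Function.extend Subtype.val g 0, (MeasurableEmbedding.subtype_coe hUm).measurable_extend
    hg measurable_const, fun y => ?_, fun f K hf hK hKU h0 => ?_⟩
  · by_cases hy : y ∈ U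
    · rw [Subtype.val_injective.extend_apply g 0 (⟨y, hy⟩ : U)]
      exact hg1 _
    · rw [Function.extend_apply' _ _ _ (by rintro ⟨a, rfl⟩; exact hy a.2)]
      simp
  · obtain ⟨f', hf'⟩ := IsExtensionByZero.exists_extend_eq hf hK hKU h0
    have hff' : α.extendByZero hU.isOpen f' = f := Subtype.ext hf'
    rw [← hff', ← LinearMap.comp_apply, hgΨ,
      ← setIntegral_eq_integral_of_forall_compl_eq_zero (s := U) fun y hy => by
        rw [α.extendByZero_apply_of_notMem _ _ hy, zero_mul],
      ← integral_subtype_comap hUm]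
    refine integral_congr_ae (Eventually.of_forall fun y => ?_)
    simp only [α.extendByZero_apply, Subtype.val_injective.extend_apply]

/-- A linear form on `𝒞_c(Y)` which is dominated on each `C_c(U)` by the `L¹` norm of `μ ∘ α` is
integration against `φ (μ ∘ α)` for some function `φ` bounded by `1`. -/
theorem FullContinuousSystem.exists_density (hY : LocallyCompactLocallyHausdorff Y)
    (μ : Measure X) [IsFiniteMeasure μ] [μ.Regular] (Ψ : CcL1 α →ₗ[ℂ] ℂ)
    (hΨ : ∀ f : CcL1 α, IsExtensionByZero (f : Y → ℂ) → ‖Ψ f‖ ≤ ∫ y, ‖f y‖ ∂(α.comp μ)) :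
    ∃ φ : Y → ℂ, Measurable φ ∧ (∀ y, ‖φ y‖ ≤ 1) ∧
      ∀ f : CcL1 α, Ψ f = ∫ y, f y * φ y ∂(α.comp μ) := by
  choose φ hφ hφ1 hφΨ using fun (U : Set Y) (hU : α.IsUniformlyFinite U) =>
    hU.exists_density hY μ Ψ hΨ
  obtain ⟨V, hV, -, hcov⟩ := α.exists_cover_isUniformlyFinite hY
  have hVm : ∀ n, MeasurableSet (V n) := fun n => (hV n).isOpen.measurableSet
  have hdcov : ⋃ n, disjointed V n = univ := by rw [iUnion_disjointed, hcov]
  -- The pieces are disjoint, so the compatibility condition on overlaps is vacuous.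
  obtain ⟨θ, hθ, hθV⟩ := exists_measurable_piecewise (disjointed V)
    (fun n => MeasurableSet.disjointed hVm n) (fun n => φ (V n) (hV n)) (fun n => hφ _ _)
    (fun i j hij y hy => ((disjoint_disjointed V hij).le_bot hy).elim)
  -- Both local densities represent `Ψ` on functions with compact support in `U ∩ U'`, which
  -- determine a density there almost everywhere.
  have hcongr : ∀ U U' (hU : α.IsUniformlyFinite U) (hU' : α.IsUniformlyFinite U'),
      ∀ᵐ y ∂(α.comp μ), y ∈ U ∩ U' → φ U hU y = φ U' hU' y := by
    intro U U' hU hU'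
    have hW := hU.mono (hU.isOpen.inter hU'.isOpen) inter_subset_left
    have := hU.t2Space
    have := hU'.t2Space
    rw [← ae_restrict_iff' hW.isOpen.measurableSet]
    refine (hW.ae_restrict_eq_zero hY μ ((hφ U hU).sub (hφ U' hU')) (c := 1 + 1)
      (Eventually.of_forall fun y => (norm_sub_le _ _).trans (add_le_add (hφ1 _ _ _) (hφ1 _ _ _)))
      fun f K hf hK hKW h0 => ?_).mono fun y hy => sub_eq_zero.1 hy
    have hKU := hKW.trans inter_subset_left
    have hKU' := hKW.trans inter_subset_right
    have h1 := hφΨ U hU f K (continuousOn_of_isCompact hW.isOpen hf hK hKU hKW h0) hK hKU h0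
    have h2 := hφΨ U' hU' f K (continuousOn_of_isCompact hW.isOpen hf hK hKU' hKW h0) hK hKU' h0
    have hint := α.integrable_comp hY μ f
    simp only [Pi.sub_apply, mul_sub]
    rw [integral_sub
      (hint.mul_bdd (hφ U hU).aestronglyMeasurable (Eventually.of_forall (hφ1 U hU)))
      (hint.mul_bdd (hφ U' hU').aestronglyMeasurable (Eventually.of_forall (hφ1 U' hU'))),
      ← h1, ← h2, sub_self]
  have hθU : ∀ U (hU : α.IsUniformlyFinite U), ∀ᵐ y ∂(α.comp μ), y ∈ U → θ y = φ U hU y := by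
    intro U hU
    filter_upwards [ae_all_iff.2 fun n => hcongr (V n) U (hV n) hU] with y hy hyU
    obtain ⟨n, hn⟩ := mem_iUnion.1 (hdcov ▸ mem_univ y)
    rw [hθV n hn]
    exact hy n ⟨disjointed_subset V n hn, hyU⟩
  have hθ1 : ∀ y, ‖θ y‖ ≤ 1 := fun y => by
    obtain ⟨n, hn⟩ := mem_iUnion.1 (hdcov ▸ mem_univ y)
    rw [hθV n hn]
    exact hφ1 _ _ _
  refine ⟨θ, hθ, hθ1, fun ⟨f, hf⟩ => ?_⟩
  have hint : ∀ f : CcL1 α, Integrable (fun y => f y * θ y) (α.comp μ) := fun f =>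
    (α.integrable_comp hY μ f).mul_bdd hθ.aestronglyMeasurable (Eventually.of_forall hθ1)
  induction hf using Submodule.span_induction with
  | mem f hf =>
    have hfs : f ∈ Cc Y := Submodule.subset_span hf
    obtain ⟨U, hU, hT, hc, K, hK, hKU, h0⟩ := hf
    -- `U` itself need not be uniformly finite, so it is shrunk around the support of `f`.
    obtain ⟨W, hW, hKW, hWU⟩ := α.exists_isUniformlyFinite_superset hY hU hK hKU
    refine (hφΨ W hW (⟨f, hfs⟩ : CcL1 α) K (hc.mono hWU) hK hKW h0).trans
      (integral_congr_ae ((hθU W hW).mono fun y hy => ?_))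
    by_cases hyW : y ∈ W
    · simp only [hy hyW]
    · simp only [h0 y fun h => hyW (hKW h), zero_mul]
  | zero =>
    have : Ψ ⟨0, Submodule.zero_mem _⟩ = 0 := map_zero Ψ
    simp [this]
  | add f g hf' hg' hf hg =>
    have : Ψ ⟨f + g, Submodule.add_mem _ hf' hg'⟩ = Ψ ⟨f, hf'⟩ + Ψ ⟨g, hg'⟩ :=
      map_add Ψ (⟨f, hf'⟩ : CcL1 α) ⟨g, hg'⟩
    rw [this, hf, hg, ← integral_add (hint ⟨f, hf'⟩) (hint ⟨g, hg'⟩)]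
    simp only [Pi.add_apply, add_mul]
  | smul c f hf' hf =>
    have : Ψ ⟨c • f, Submodule.smul_mem _ c hf'⟩ = c • Ψ ⟨f, hf'⟩ :=
      map_smul Ψ c (⟨f, hf'⟩ : CcL1 α)
    rw [this, hf, ← integral_smul]
    simp only [Pi.smul_apply, smul_mul_assoc]

/-- An element of `L^∞` has a measurable representative which is bounded everywhere by its norm. -/
theorem _root_.MeasureTheory.Lp.exists_measurable_norm_le {Ω : Type*} [MeasurableSpace Ω]
    {ν : Measure Ω} (φ : Lp ℂ ∞ ν) :
    ∃ g : Ω → ℂ, Measurable g ∧ (∀ y, ‖g y‖ ≤ ‖φ‖) ∧ φ =ᵐ[ν] g := by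
  have hm := (Lp.stronglyMeasurable φ).measurable
  have hA : MeasurableSet {y | ‖φ y‖ ≤ ‖φ‖} := measurableSet_le hm.norm measurable_const
  have hae : ∀ᵐ y ∂ν, ‖φ y‖ ≤ ‖φ‖ := by
    filter_upwards [ae_le_eLpNormEssSup (f := φ) (μ := ν)] with y hy
    rw [Lp.norm_def, eLpNorm_exponent_top, ← toReal_enorm]
    refine ENNReal.toReal_mono ?_ hy
    rw [← eLpNorm_exponent_top]
    exact Lp.eLpNorm_ne_top φ
  refine ⟨{y | ‖φ y‖ ≤ ‖φ‖}.indicator φ, hm.indicator hA, fun y => ?_, hae.mono fun y hy => ?_⟩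
  · by_cases hy : ‖φ y‖ ≤ ‖φ‖
    · simp [indicator, hy]
    · simp [indicator, hy]
  · simp [indicator, hy]

theorem FullContinuousSystem.norm_integral_mul_le (hY : LocallyCompactLocallyHausdorff Y)
    (μ : Measure X) [IsFiniteMeasure μ] {g : Y → ℂ} {c : ℝ}
    (hc : ∀ᵐ y ∂(α.comp μ), ‖g y‖ ≤ c) (hc0 : 0 ≤ c) (f : CcL1 α) :
    ‖∫ y, f y * g y ∂(α.comp μ)‖ ≤ μ.real univ * c * ‖f‖ := by
  have hint := (α.integrable_comp hY μ f).norm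
  calc ‖∫ y, f y * g y ∂(α.comp μ)‖ ≤ ∫ y, c * ‖f y‖ ∂(α.comp μ) := by
        refine norm_integral_le_of_norm_le (hint.const_mul c) (hc.mono fun y hy => ?_)
        rw [norm_mul, mul_comm]
        exact mul_le_mul_of_nonneg_right hy (norm_nonneg _)
    _ = c * ∫ y, ‖f y‖ ∂(α.comp μ) := integral_const_mul _ _
    _ ≤ c * (‖f‖ * μ.real univ) := by
        gcongr
        exact α.integral_norm_comp_le hY μ f
    _ = _ := by ring

theorem eq_of_forall_coe_eq {Φ Φ' : StrongDual ℂ (C0L1 α)}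
    (h : ∀ f : CcL1 α, Φ (f : C0L1 α) = Φ' (f : C0L1 α)) : Φ = Φ' := by
  refine ContinuousLinearMap.ext fun z => ?_
  induction z using UniformSpace.Completion.induction_on with
  | hp => exact isClosed_eq Φ.continuous Φ'.continuous
  | ih f => exact h f

theorem norm_le_of_forall_coe {Φ : StrongDual ℂ (C0L1 α)} {c : ℝ} (hc : 0 ≤ c)
    (h : ∀ f : CcL1 α, ‖Φ (f : C0L1 α)‖ ≤ c * ‖f‖) : ‖Φ‖ ≤ c := by
  refine Φ.opNorm_le_bound hc fun z => ?_
  induction z using UniformSpace.Completion.induction_on with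
  | hp => exact isClosed_le Φ.continuous.norm (continuous_const.mul continuous_norm)
  | ih f => simpa only [UniformSpace.Completion.norm_coe] using h f

/-- The bound `|∫ f φ d(μ ∘ α)| ≤ μ(X) ‖φ‖ ‖f‖` lets the integral extend from the dense subspace
`𝒞_c(Y)` to its completion, in one way only. -/
theorem existsUnique_isIntegrationAgainst (hY : LocallyCompactLocallyHausdorff Y)
    (μ : Measure X) [IsFiniteMeasure μ] (φ : Lp ℂ ∞ (α.comp μ)) :
    ∃! Φ : StrongDual ℂ (C0L1 α), IsIntegrationAgainst α Φ μ φ := by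
  obtain ⟨g, hg, hgφ, hφg⟩ := Lp.exists_measurable_norm_le φ
  have hint : ∀ f : CcL1 α, Integrable (fun y => f y * φ y) (α.comp μ) := fun f =>
    (α.integrable_comp hY μ f).mul_bdd (Lp.aestronglyMeasurable φ)
      (hφg.mono fun y hy => by rw [hy]; exact hgφ y)
  let Ψ : CcL1 α →ₗ[ℂ] ℂ :=
    { toFun := fun f => ∫ y, f y * φ y ∂(α.comp μ)
      map_add' := fun f f' => by
        rw [← integral_add (hint f) (hint f')]
        exact integral_congr_ae (Eventually.of_forall fun y => add_mul (f y) (f' y) (φ y))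
      map_smul' := fun c f => by
        rw [RingHom.id_apply, ← integral_smul]
        exact integral_congr_ae (Eventually.of_forall fun y => smul_mul_assoc c (f y) (φ y)) }
  let Ψ' : StrongDual ℂ (CcL1 α) := Ψ.mkContinuous (μ.real univ * ‖φ‖) fun f =>
    FullContinuousSystem.norm_integral_mul_le hY μ (hφg.mono fun y hy => by rw [hy]; exact hgφ y)
      (norm_nonneg φ) f
  have hd : DenseRange (UniformSpace.Completion.toComplL (𝕜 := ℂ) (E := CcL1 α)) :=
    UniformSpace.Completion.denseRange_coe
  refine ⟨Ψ'.extend UniformSpace.Completion.toComplL, fun f => ?_, fun Φ hΦ =>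
    eq_of_forall_coe_eq fun f => ?_⟩
  · exact Ψ'.extend_eq hd (UniformSpace.Completion.isUniformInducing_coe _) f
  · rw [hΦ f]
    exact (Ψ'.extend_eq hd (UniformSpace.Completion.isUniformInducing_coe _) f).symm

theorem IsIntegrationAgainst.norm_le (hY : LocallyCompactLocallyHausdorff Y) {μ : Measure X}
    [IsFiniteMeasure μ] {φ : Lp ℂ ∞ (α.comp μ)} {Φ : StrongDual ℂ (C0L1 α)}
    (h : IsIntegrationAgainst α Φ μ φ) : ‖Φ‖ ≤ μ.real univ * ‖φ‖ := by
  obtain ⟨g, hg, hgφ, hφg⟩ := Lp.exists_measurable_norm_le φ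
  refine norm_le_of_forall_coe (by positivity) fun f => ?_
  rw [h f]
  exact FullContinuousSystem.norm_integral_mul_le hY μ
    (hφg.mono fun y hy => by rw [hy]; exact hgφ y) (norm_nonneg φ) f

/-- A continuous linear form is integration against `φ (μ ∘ α)` with `‖φ‖ ≤ 1` and `μ(X) ≤ ‖Φ‖`. -/
theorem exists_isIntegrationAgainst [LocallyCompactSpace X]
    (hY : LocallyCompactLocallyHausdorff Y) (Φ : StrongDual ℂ (C0L1 α)) :
    ∃ (μ : Measure X) (_ : IsFiniteMeasure μ) (_ : μ.Regular) (φ : Y → ℂ), μ.real univ ≤ ‖Φ‖ ∧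
      Measurable φ ∧ (∀ y, ‖φ y‖ ≤ 1) ∧
      ∀ f : CcL1 α, Φ (f : C0L1 α) = ∫ y, f y * φ y ∂(α.comp μ) := by
  let Ψ : CcL1 α →ₗ[ℂ] ℂ := (Φ.comp UniformSpace.Completion.toComplL).toLinearMap
  have hΨ : ∀ f, ‖Ψ f‖ ≤ ‖Φ‖ * ‖f‖ := fun f => by
    have := Φ.le_opNorm (f : C0L1 α)
    rwa [UniformSpace.Completion.norm_coe] at this
  obtain ⟨μ, hμ, hμr, hμΦ, hdom⟩ :=
    FullContinuousSystem.exists_dominating_measure hΨ hY (norm_nonneg Φ)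
  obtain ⟨φ, hφ, hφ1, hφΨ⟩ := FullContinuousSystem.exists_density hY μ Ψ hdom
  exact ⟨μ, hμ, hμr, φ, hμΦ, hφ, hφ1, hφΨ⟩

end Representation

end FibredMeasure

/-! ### The proposition. -/

theorem proposition2p5 {X Y : Type*}
    [TopologicalSpace X] [LocallyCompactSpace X] [T2Space X] [MeasurableSpace X] [BorelSpace X]
    [TopologicalSpace Y] [SigmaCompactSpace Y] [MeasurableSpace Y] [BorelSpace Y]
    (hY : LocallyCompactLocallyHausdorff Y)
    (π : C(Y, X)) (hπ : Function.Surjective π) (hfib : ∀ x : X, T2Space (π ⁻¹' {x}))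
    (α : FullContinuousSystem π) :
    (∀ Φ : StrongDual ℂ (C0L1 α), ∃ ν : Set Y → ℂ,
      IsComplexBorelRadon ν ∧
      (∀ (μ : Measure X) [IsFiniteMeasure μ] [μ.Regular] (φ : Lp ℂ ∞ (α.comp μ)),
        IsIntegrationAgainst α Φ μ φ ↔ EqDensity α ν μ φ) ∧
      (∃ (μ : Measure X) (_ : IsFiniteMeasure μ) (_ : μ.Regular) (φ : Lp ℂ ∞ (α.comp μ)),
        EqDensity α ν μ φ) ∧
      IsGLB {r : ℝ | ∃ (μ : Measure X) (_ : IsFiniteMeasure μ) (_ : μ.Regular)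
        (φ : Lp ℂ ∞ (α.comp μ)), EqDensity α ν μ φ ∧ r = μ.real Set.univ * ‖φ‖} ‖Φ‖) ∧
    (∀ (μ : Measure X) [IsFiniteMeasure μ] [μ.Regular] (φ : Lp ℂ ∞ (α.comp μ)),
      ∃! Φ : StrongDual ℂ (C0L1 α), IsIntegrationAgainst α Φ μ φ) := by
  refine ⟨fun Φ => ?_, fun μ _ _ φ => existsUnique_isIntegrationAgainst hY μ φ⟩
  obtain ⟨μ₀, _, _, φ₀, hμ₀, hφ₀, hφ₀1, hΦ⟩ := exists_isIntegrationAgainst hY Φ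
  -- With `ν` defined by the one representation `(μ₀, φ₀)`, any other is compared with it through
  -- bounded measurable representatives.
  have hiff : ∀ (μ : Measure X) [IsFiniteMeasure μ] [μ.Regular] (φ : Lp ℂ ∞ (α.comp μ)),
      IsIntegrationAgainst α Φ μ φ ↔
        EqDensity α (fun B => ∫ y in B, φ₀ y ∂(α.comp μ₀)) μ φ := by
    intro μ _ _ φ
    obtain ⟨g, hg, hgφ, hφg⟩ := Lp.exists_measurable_norm_le φ
    have h := α.forall_integral_eq_iff hY μ₀ μ hφ₀ hg hφ₀1 hgφ
    have h1 : ∀ f : CcL1 α, ∫ y, f y * φ y ∂(α.comp μ) = ∫ y, f y * g y ∂(α.comp μ) := fun f =>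
      integral_congr_ae (hφg.mono fun y hy => by simp only [hy])
    have h2 : ∀ B, ∫ y in B, φ y ∂(α.comp μ) = ∫ y in B, g y ∂(α.comp μ) := fun B =>
      integral_congr_ae (ae_restrict_of_ae hφg)
    simpa only [IsIntegrationAgainst, EqDensity, hΦ, h1, h2] using h
  have hmem : MemLp φ₀ ∞ (α.comp μ₀) :=
    memLp_top_of_bound hφ₀.aestronglyMeasurable 1 (Eventually.of_forall hφ₀1)
  have hrep : EqDensity α (fun B => ∫ y in B, φ₀ y ∂(α.comp μ₀)) μ₀ hmem.toLp := fun B _ =>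
    integral_congr_ae (ae_restrict_of_ae hmem.coeFn_toLp.symm)
  have hnorm : ‖hmem.toLp‖ ≤ 1 := by
    rw [Lp.norm_toLp]
    refine ENNReal.toReal_le_of_le_ofReal zero_le_one ?_
    rw [eLpNorm_exponent_top]
    exact eLpNormEssSup_le_of_ae_bound (Eventually.of_forall hφ₀1)
  refine ⟨_, α.isComplexBorelRadon hY μ₀ hφ₀ hφ₀1, hiff, ⟨μ₀, inferInstance, inferInstance, _, hrep⟩,
    ?_, fun b hb => ?_⟩
  · rintro _ ⟨μ, _, _, φ, hφ, rfl⟩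
    exact ((hiff μ φ).2 hφ).norm_le hY
  -- The infimum is attained at `(μ₀, φ₀)`, because `μ₀(X) ≤ ‖Φ‖` and `‖φ₀‖ ≤ 1`.
  · refine (hb ⟨μ₀, inferInstance, inferInstance, _, hrep, rfl⟩).trans ?_
    exact (mul_le_of_le_one_right measureReal_nonneg hnorm).trans hμ₀
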